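/- **Setting.** Let $T\in(0,\infty)$, let $(\Omega,\mathcal F,\mathbb P)$ be a probability space and $(K,\mathcal K)$ a Lusin (standard Borel) space. Let $(S_n,X_n)_{n\ge1}$ be a non-explosive marked point process: $S_n$ takes values in $(0,T]\cup\{\infty\}$, $X_n$ takes values in $K$, $S_0=0$, $S_n\le S_{n+1}$ everywhere, a.s. $S_n<S_{n+1}$ whenever $S_n\le T$, and $\Omega=\bigcup_n\{S_n>T\}$. Let $\mu=\sum_{n\ge1:\,S_n\le T}\delta_{(S_n,X_n)}$, let $(\mathcal F_t)$ be the smallest filtration for which every $S_n$ is a stopping time and every $X_n$ is $\mathcal F_{S_n}$-measurable, and let $\mathcal P$ be its predictable $\sigma$-field; a function on $\Omega\times[0,T]\times G$ is called predictable if it is $\mathcal P\otimes\mathcal G$-measurable. Let $\nu(dt,dx)=dA_t\,\phi_t(dx)$ be the predictable compensator of $\mu$, where $A$ is a predictable increasing process with $A_0=0$ and $\phi$ is a transition probability from $(\Omega\times[0,T],\mathcal P)$ to $K$; that is, $\mathbb E\int H\,d\mu=\mathbb E\int H\,d\nu$ for every predictable $H\ge0$. Assume that $A$ is a.s. continuous.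 Let $p>1$, $\epsilon>0$, $L,L'\ge0$, $c_\epsilon=\bigl(1-(1+\epsilon)^{-1/(p-1)}\bigr)^{1-p}$ and $$\beta>1+\frac{c_\epsilon}{1+\epsilon}+pL'+(p-1)\bigl((L+1)^p(1+\epsilon)\bigr)^{1/(p-1)} .$$ Let $\xi$ be $\mathcal F_T$-measurable with $\mathbb E[e^{\beta A_T}|\xi|^p]<\infty$. Let $f(\omega,t,x,y,\zeta)$ be real valued, for $\omega\in\Omega$, $t\in[0,T]$, $x\in K$, $y\in\mathbb R$ and $\zeta$ a Borel function on $K$, such that: $(\omega,t,x,y)\mapsto f(\omega,t,x,y,Z_{\omega,t}(\cdot))$ is predictable for every predictable $Z$ on $\Omega\times[0,T]\times K$; for all arguments, $|f(\omega,t,x,y',\zeta)-f(\omega,t,x,y,\zeta)|\le L'|y'-y|$ and $\int_K|f(\omega,t,x,y,\zeta)-f(\omega,t,x,y,\zeta')|\,\phi_{\omega,t}(dx)\le L\bigl(\int_K|\zeta'-\zeta|^p\,d\phi_{\omega,t}\bigr)^{1/p}$; and $\mathbb E\int_0^T\!\int_K e^{\beta A_t}|f(t,x,0,0)|^p\,\nu(dt,dx)<\infty$.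 A *solution* of the BSDE with data $(\xi,f)$ is a pair $(Y,Z)$ with $Y$ adapted and càdlàg on $[0,T]$, $Z$ predictable, $\int_0^T\!\int_K|Z|\,d\nu<\infty$ a.s., the $\nu$-integral of $f(s,x,Y_{s-},Z_s(\cdot))$ over $(0,T]\times K$ absolutely convergent a.s., and, outside a $\mathbb P$-null set, for all $t\in[0,T]$, $$Y_t+\int_t^T\!\!\int_K Z(s,x)\,\mu(ds,dx)=\xi+\int_t^T\!\!\int_K f(s,x,Y_{s-},Z_s(\cdot))\,\nu(ds,dx).$$ It is in $L^p_\beta$ if $\|(Y,Z)\|:=\mathbb E\int_0^T\!\int_K(|Y_s|^p+|Z(s,x)|^p)e^{\beta A_s}\,\nu(ds,dx)<\infty$. **Proposition.** There is a constant $C$, depending only on $(p,\epsilon,\beta,L,L')$ (in particular not on $m$), with the following property. Let $(Y,Z)\in L^p_\beta$ be a solution with data $(\xi,f)$ and, for $m\ge1$, let $(Y^m,Z^m)\in L^p_\beta$ be a solution with the truncated data $\bigl(\xi 1_{\{T<S_m\}},\,f\,1_{\{s\le S_m\}}\bigr)$. Then $$\mathbb E\int_0^T\!\!\int_K\bigl(|Y_s-Y^m_s|^p+|Z(s,x)-Z^m(s,x)|^p\bigr)e^{\beta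 A_s}\,\nu(ds,dx)\le C\,\mathbb E\Bigl[|\xi|^pe^{\beta A_T}1_{\{S_m<T\}}+\int_{S_m\wedge T}^T\!\int_K|f(s,x,0,0)|^pe^{\beta A_s}\,\nu(ds,dx)\Bigr].$$ Moreover, if such $(Y^m,Z^m)$ are given for all $m\ge1$, then $\|(Y-Y^m,Z-Z^m)\|\to0$ as $m\to\infty$. -/

import Mathlib

open MeasureTheory ProbabilityTheory Set Filter
open scoped NNReal ENNReal Topology

noncomputable section

namespace BSDE

/-- A non-explosive marked point process `(S n, X n)`, `n ≥ 1`, on `[0, T] × K`. Jump times that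
do not occur before the horizon have the value `∞`; the marks are irrelevant there, and the mark
of index `0` is never used. -/
structure MarkedPointProcess {Ω : Type*} [MeasurableSpace Ω] (P : Measure Ω)
    (K : Type*) [MeasurableSpace K] (T : ℝ≥0) where
  /-- the jump times -/
  S : ℕ → Ω → ℝ≥0∞
  /-- the marks -/
  X : ℕ → Ω → K
  measurable_S : ∀ n, Measurable (S n)
  measurable_X : ∀ n, Measurable (X n)
  S_zero : ∀ ω, S 0 ω = 0
  S_pos : ∀ n, 1 ≤ n → ∀ ω, 0 < S n ω
  S_range : ∀ n, 1 ≤ n → ∀ ω, S n ω ≤ T ∨ S n ω = ∞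
  S_mono : ∀ n ω, S n ω ≤ S (n + 1) ω
  S_strict : ∀ᵐ ω ∂P, ∀ n, S n ω ≤ T → S n ω < S (n + 1) ω
  non_explosive : ∀ ω, ∃ n, (T : ℝ≥0∞) < S n ω

namespace MarkedPointProcess

variable {Ω : Type*} [mΩ : MeasurableSpace Ω] {P : Measure Ω}
  {K : Type*} [mK : MeasurableSpace K] {T : ℝ≥0}

/-- The filtration generated by the point process: the smallest one for which each `S n` is a
stopping time and each `X n` is measurable with respect to the σ-field of `S n`, `n ≥ 1`. -/
def filtration (N : MarkedPointProcess P K T) : Filtration ℝ≥0 mΩ where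
  seq t := MeasurableSpace.generateFrom
    {E | ∃ n, 1 ≤ n ∧ ∃ s : ℝ≥0, s ≤ t ∧ ∃ B : Set K, MeasurableSet B ∧
      E = {ω | N.S n ω ≤ s ∧ N.X n ω ∈ B}}
  mono' := by
    intro t u htu
    apply MeasurableSpace.generateFrom_mono
    rintro E ⟨n, hn, s, hs, B, hB, rfl⟩
    exact ⟨n, hn, s, hs.trans htu, B, hB, rfl⟩
  le' := by
    intro t
    apply MeasurableSpace.generateFrom_le
    rintro E ⟨n, -, s, -, B, hB, rfl⟩
    exact (measurableSet_le (N.measurable_S n) measurable_const).inter (N.measurable_X n hB)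

/-- The predictable σ-field on (time) × Ω. -/
abbrev predictableSigma (N : MarkedPointProcess P K T) : MeasurableSpace (ℝ≥0 × Ω) :=
  N.filtration.predictable

/-- The random counting measure `μ = ∑_{n ≥ 1, S n ≤ T} δ_(S n, X n)`. -/
def jumpMeasure (N : MarkedPointProcess P K T) (ω : Ω) : Measure (ℝ≥0 × K) :=
  open Classical in
  Measure.sum fun n : ℕ =>
    if N.S (n + 1) ω ≤ T then Measure.dirac ((N.S (n + 1) ω).toNNReal, N.X (n + 1) ω) else 0

/-- A function on `Ω × [0, T] × G` is predictable: it is measurable for the product of the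
predictable σ-field on `Ω × [0, T]` with the σ-field of `G`. Values at times after `T` are
irrelevant. -/
def IsPredictable (N : MarkedPointProcess P K T) {G : Type*} [mG : MeasurableSpace G]
    (H : ℝ≥0 → Ω → G → ℝ) : Prop :=
  Measurable[N.predictableSigma.prod mG]
    fun q : (ℝ≥0 × Ω) × G => if q.1.1 ≤ T then H q.1.1 q.1.2 q.2 else 0

lemma measurable_swap_predictable (N : MarkedPointProcess P K T) :
    Measurable[mΩ.prod inferInstance, N.predictableSigma] (Prod.swap : Ω × ℝ≥0 → ℝ≥0 × Ω) := by
  apply measurable_generateFrom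
  rintro E (⟨A, hA, rfl⟩ | ⟨i, A, hA, rfl⟩)
  · exact measurable_swap ((measurableSet_singleton _).prod (N.filtration.le _ _ hA))
  · exact measurable_swap (measurableSet_Ioi.prod (N.filtration.le _ _ hA))

/-- The random measure `dA_t(ω) φ_{ω,t}(dx)` on (time) × K. -/
def disintegrated (N : MarkedPointProcess P K T) (dA : Kernel Ω ℝ≥0)
    (φ : Kernel[N.predictableSigma] (ℝ≥0 × Ω) K) : Kernel Ω (ℝ≥0 × K) :=
  dA.compProd (Kernel.comap (mα := N.predictableSigma) φ Prod.swap
    N.measurable_swap_predictable)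

/-- A disintegrated version `ν(dt, dx) = dA_t φ_t(dx)` of the predictable compensator of the
counting measure. The increasing process `A` is given through its random Stieltjes measure `dA`,
so that `A_t = dA [0, t]`. -/
structure Compensator (N : MarkedPointProcess P K T) where
  /-- the measures `dA_t(ω)` -/
  dA : Kernel Ω ℝ≥0
  /-- the transition probability `φ_{ω,t}(dx)` -/
  φ : Kernel[N.predictableSigma] (ℝ≥0 × Ω) K
  sFinite_dA : IsSFiniteKernel dA
  prob_φ : ∀ q, IsProbabilityMeasure (φ q)
  finite_dA : ∀ᵐ ω ∂P, dA ω univ < ∞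
  zero_dA : ∀ᵐ ω ∂P, dA ω {0} = 0
  predictable_A : Measurable[N.predictableSigma] fun q : ℝ≥0 × Ω => (dA q.2 (Iic q.1)).toReal
  compensates : ∀ H : (ℝ≥0 × Ω) × K → ℝ≥0∞, Measurable[N.predictableSigma.prod mK] H →
    ∫⁻ ω, ∫⁻ q, H ((q.1, ω), q.2) ∂(N.jumpMeasure ω) ∂P
      = ∫⁻ ω, ∫⁻ q, H ((q.1, ω), q.2) ∂(N.disintegrated dA φ ω) ∂P

namespace Compensator

variable {N : MarkedPointProcess P K T}

/-- The compensator `ν`. -/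
def ν (c : N.Compensator) : Kernel Ω (ℝ≥0 × K) := N.disintegrated c.dA c.φ

/-- The increasing process `A`. -/
def A (c : N.Compensator) (t : ℝ≥0) (ω : Ω) : ℝ := (c.dA ω (Iic t)).toReal

/-- Almost surely the path of `A` is continuous. -/
def ContinuousA (c : N.Compensator) : Prop :=
  ∀ᵐ ω ∂P, Continuous fun t => c.A t ω

/-- The weight `e^{β A_t}`. -/
def weight (c : N.Compensator) (β : ℝ) (t : ℝ≥0) (ω : Ω) : ℝ≥0∞ :=
  ENNReal.ofReal (Real.exp (β * c.A t ω))

/-- `E ∫_0^T ∫_K (|Y_s|^p + |Z_s(x)|^p) e^{β A_s} ν(ds, dx)`. -/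
def normLp (c : N.Compensator) (p β : ℝ) (Y : ℝ≥0 → Ω → ℝ) (Z : ℝ≥0 → Ω → K → ℝ) : ℝ≥0∞ :=
  ∫⁻ ω, ∫⁻ q in Ioc 0 T ×ˢ univ,
    (‖Y q.1 ω‖ₑ ^ p + ‖Z q.1 ω q.2‖ₑ ^ p) * c.weight β q.1 ω ∂(c.ν ω) ∂P

/-- `(Y, Z)` represents an element of `L^p_β`. Stopping `Y` at `T` makes values after `T`
irrelevant. -/
structure MemLp (c : N.Compensator) (p β : ℝ) (Y : ℝ≥0 → Ω → ℝ) (Z : ℝ≥0 → Ω → K → ℝ) :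
    Prop where
  progressive : IsStronglyProgressive N.filtration fun t => Y (min t T)
  predictable : N.IsPredictable Z
  norm_lt_top : c.normLp p β Y Z < ∞

/-- The conditions on the terminal value. -/
structure TerminalHyp (c : N.Compensator) (p β : ℝ) (ξ : Ω → ℝ) : Prop where
  measurable : Measurable[N.filtration T] ξ
  integrable : ∫⁻ ω, c.weight β T ω * ‖ξ ω‖ₑ ^ p ∂P < ∞

/-- The conditions on the generator `f(ω, t, x, y, ζ)`, for times in `[0, T]` and
Borel functions `ζ` on `K`. -/
structure GeneratorHyp (c : N.Compensator) (p β : ℝ) (L L' : ℝ≥0)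
    (f : Ω → ℝ≥0 → K → ℝ → (K → ℝ) → ℝ) : Prop where
  predictable : ∀ Z : ℝ≥0 → Ω → K → ℝ, N.IsPredictable Z →
    N.IsPredictable fun t ω (g : K × ℝ) => f ω t g.1 g.2 (Z t ω)
  lipschitz_y : ∀ ω, ∀ t ≤ T, ∀ x y y', ∀ ζ : K → ℝ, Measurable ζ →
    |f ω t x y' ζ - f ω t x y ζ| ≤ L' * |y' - y|
  lipschitz_z : ∀ ω, ∀ t ≤ T, ∀ y, ∀ ζ ζ' : K → ℝ, Measurable ζ → Measurable ζ' →
    ∫⁻ x, ‖f ω t x y ζ - f ω t x y ζ'‖ₑ ∂(c.φ (t, ω))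
      ≤ L * (∫⁻ v, ‖ζ' v - ζ v‖ₑ ^ p ∂(c.φ (t, ω))) ^ (1 / p)
  integrable : ∫⁻ ω, ∫⁻ q in Ioc 0 T ×ˢ univ,
    c.weight β q.1 ω * ‖f ω q.1 q.2 0 0‖ₑ ^ p ∂(c.ν ω) ∂P < ∞

/-- `(Y, Z)` is a solution of the backward equation
`Y_t + ∫_(t,T] ∫_K Z_s(x) μ(ds, dx) = ξ + ∫_(t,T] ∫_K f(s, x, Y_{s-}, Z_s) ν(ds, dx)`. -/
structure IsSolution (c : N.Compensator) (ξ : Ω → ℝ) (f : Ω → ℝ≥0 → K → ℝ → (K → ℝ) → ℝ)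
    (Y : ℝ≥0 → Ω → ℝ) (Z : ℝ≥0 → Ω → K → ℝ) : Prop where
  adapted : ∀ t ≤ T, Measurable[N.filtration t] (Y t)
  right_continuous : ∀ ω, ∀ t < T, ContinuousWithinAt (fun s => Y s ω) (Ici t) t
  left_limits : ∀ ω, ∀ t ≤ T, ∃ l, Tendsto (fun s => Y s ω) (𝓝[<] t) (𝓝 l)
  predictable : N.IsPredictable Z
  integrable_Z : ∀ᵐ ω ∂P, ∫⁻ q in Ioc 0 T ×ˢ univ, ‖Z q.1 ω q.2‖ₑ ∂(c.ν ω) < ∞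
  integrable_f : ∀ᵐ ω ∂P, IntegrableOn
    (fun q : ℝ≥0 × K => f ω q.1 q.2 (Function.leftLim (fun s => Y s ω) q.1) (Z q.1 ω))
    (Ioc 0 T ×ˢ univ) (c.ν ω)
  equation : ∀ᵐ ω ∂P, ∀ t ≤ T,
    Y t ω + ∫ q in Ioc t T ×ˢ univ, Z q.1 ω q.2 ∂(N.jumpMeasure ω)
      = ξ ω + ∫ q in Ioc t T ×ˢ univ,
          f ω q.1 q.2 (Function.leftLim (fun s => Y s ω) q.1) (Z q.1 ω) ∂(c.ν ω)

/-- `E[|ξ|^p e^{β A_T} 1_{S_m < T} + ∫_{S_m ∧ T}^T ∫_K |f(s, x, 0, 0)|^p e^{β A_s} ν(ds, dx)]`. -/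
def errorBound (c : N.Compensator) (p β : ℝ) (ξ : Ω → ℝ)
    (f : Ω → ℝ≥0 → K → ℝ → (K → ℝ) → ℝ) (m : ℕ) : ℝ≥0∞ :=
  ∫⁻ ω, ({ω | N.S m ω < T}.indicator (fun ω => ‖ξ ω‖ₑ ^ p * c.weight β T ω) ω
    + ∫⁻ q in {q : ℝ≥0 × K | min (N.S m ω) T < q.1 ∧ q.1 ≤ T},
        ‖f ω q.1 q.2 0 0‖ₑ ^ p * c.weight β q.1 ω ∂(c.ν ω)) ∂P

end Compensator

/-- The truncated terminal value `ξ 1_{T < S_m}`. -/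
def truncTerminal (N : MarkedPointProcess P K T) (m : ℕ) (ξ : Ω → ℝ) : Ω → ℝ :=
  {ω | (T : ℝ≥0∞) < N.S m ω}.indicator ξ

/-- The truncated generator `f 1_{s ≤ S_m}`. -/
def truncGenerator (N : MarkedPointProcess P K T) (m : ℕ)
    (f : Ω → ℝ≥0 → K → ℝ → (K → ℝ) → ℝ) : Ω → ℝ≥0 → K → ℝ → (K → ℝ) → ℝ :=
  fun ω s x y ζ => open Classical in if (s : ℝ≥0∞) ≤ N.S m ω then f ω s x y ζ else 0

end MarkedPointProcess

/-- The constant `c_ε = (1 - (1 / (1 + ε)) ^ (1 / (p - 1))) ^ (1 - p)`. -/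
def cEps (p ε : ℝ) : ℝ := (1 - (1 / (1 + ε)) ^ (1 / (p - 1))) ^ (1 - p)

/-- The lower bound required of `β`. -/
def betaBound (p ε L L' : ℝ) : ℝ :=
  1 + cEps p ε / (1 + ε) + p * L' + (p - 1) * ((L + 1) ^ p * (1 + ε)) ^ (1 / (p - 1))

end BSDE

end

/-! The engine is one a priori estimate on a stochastic interval `(S k, T]`. Along a path, the
change of variables formula is applied to `e^{βA}|Y|^p`. The initial value is dropped, and at a jump
time the value passes from `Y_-` to `Y_- + Z`. This bounds `β ∫ e^{βA}|Y|^p dA + ∫ e^{βA}|Y_- + Z|^p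
dμ` by the terminal term, the driver term `∫ e^{βA} p|Y|^{p-1}|G| dA` and `∫ e^{βA}|Y_-|^p dμ`
(`energy_inequality`, `path_energy`). All integrands against `μ` are predictable and nonnegative, so
in expectation `μ` may be replaced by `ν`, with no martingale or localisation argument.

Each term of the lower bound on `β` pays for one term of the resulting inequality. The `1` absorbs
`E ∫ e^{βA}|Y_-|^p dν`. The quotient `c_ε/(1+ε)` comes from `|Z|^p ≤ (1+ε)|Y+Z|^p + c_ε|Y|^p`, which
recovers the energy of `Z` from that of `Y + Z`. The summand `pL'` is the Lipschitz constant in `y`,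
and the last summand is the price of Young's inequality for the dependence on `ζ`. The strict excess
of `β` pays for the source `f(·,0,0)` and leaves a positive coefficient (`exists_isAprioriConstant`,
`apriori_estimate`). The energies are finite in `L^p_β`, hence can be absorbed.

The estimate is used twice. On `(S m, T]` the truncated data are zero, so `Y^m` and `Z^m` vanish
there (`truncated_vanishes`). It is then applied on `(0, T]` to the difference of the two solutions.
Up to `S m` the two drivers differ by Lipschitz terms only; after `S m` the difference is `(Y, Z)`
itself, whose driver is Lipschitz up to `f(·,0,0)`. Thus the only source is `f(·,0,0)` on `(S m,
T]`, and the terminal difference lives on `{S m ≤ T}`, which is a.s. `{S m < T}` because a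
continuous `A` charges no fixed time (`normLp_truncation_le`). Convergence follows from absolute
continuity of the integral, since non-explosion gives `P(S m ≤ T) → 0` (`tendsto_errorBound`). -/

noncomputable section

namespace BSDE

/-! ### Change of variables for finite-variation paths with finitely many jumps. -/

section JumpPaths

variable {E : Type*} [NormedAddCommGroup E] [NormedSpace ℝ E]

/-- Primitives with respect to an atomless measure are continuous. -/
lemma continuous_setIntegral_Ioc {m : Measure ℝ≥0} [NullSingletonClass m] {U : ℝ≥0 → E}
    (hU : Integrable U m) (a : ℝ≥0) : Continuous fun t => ∫ s in Ioc a t, U s ∂m := by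
  rw [continuous_iff_continuousAt]
  intro t
  simp_rw [← integral_indicator measurableSet_Ioc]
  refine continuousAt_of_dominated (bound := fun s => ‖U s‖) ?_ ?_ hU.norm ?_
  · exact Eventually.of_forall fun r => hU.aestronglyMeasurable.indicator measurableSet_Ioc
  · exact Eventually.of_forall fun r => Eventually.of_forall fun s =>
      norm_indicator_le_norm_self _ _
  · have : ∀ᵐ s ∂m, s ≠ t := by
      rw [ae_iff]; simp
    filter_upwards [this] with s hs
    apply ContinuousAt.congr (f := fun _ => (Ioc a t).indicator U s) continuousAt_const
    rcases lt_or_gt_of_ne hs with h | h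
    · filter_upwards [lt_mem_nhds h] with r hr
      simp only [indicator, mem_Ioc]
      simp [h.le, hr.le]
    · filter_upwards [gt_mem_nhds h] with r hr
      simp only [indicator, mem_Ioc]
      simp [not_le.2 h, not_le.2 hr]

/-- With finitely many jump times, a short enough interval to the right of `t` contains none of
them. -/
lemma sum_jumps_eventually_right {G : Type*} [AddCommGroup G] (I : Finset ℕ) (τ : ℕ → ℝ≥0)
    (w : ℕ → G) (t : ℝ≥0) :
    ∀ᶠ s in 𝓝[≥] t, ∑ i ∈ I with τ i ≤ s, w i = ∑ i ∈ I with τ i ≤ t, w i := by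
  have h : ∀ i ∈ I, ∀ᶠ s in 𝓝[≥] t, (τ i ≤ s ↔ τ i ≤ t) := by
    intro i _
    rcases le_or_gt (τ i) t with h | h
    · filter_upwards [self_mem_nhdsWithin] with s hs
      exact ⟨fun _ => h, fun _ => h.trans hs⟩
    · filter_upwards [nhdsWithin_le_nhds (gt_mem_nhds h)] with s hs
      simp [not_le.2 h, not_le.2 hs]
  filter_upwards [(eventually_all_finset I).2 h] with s hs
  rw [Finset.filter_congr hs]

lemma sum_jumps_eventually_left {G : Type*} [AddCommGroup G] (I : Finset ℕ) (τ : ℕ → ℝ≥0)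
    (w : ℕ → G) (t : ℝ≥0) :
    ∀ᶠ s in 𝓝[<] t, ∑ i ∈ I with τ i ≤ s, w i
      = ∑ i ∈ I with τ i ≤ t, w i - ∑ i ∈ I with τ i = t, w i := by
  have h : ∀ i ∈ I, ∀ᶠ s in 𝓝[<] t, (τ i ≤ s ↔ τ i < t) := by
    intro i _
    rcases lt_or_ge (τ i) t with h | h
    · filter_upwards [nhdsWithin_le_nhds (lt_mem_nhds h)] with s hs
      simp [hs.le, h]
    · filter_upwards [self_mem_nhdsWithin] with s (hs : s < t)
      simp [not_lt.2 h, not_le.2 (hs.trans_le h)]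
  filter_upwards [(eventually_all_finset I).2 h] with s hs
  rw [Finset.filter_congr hs, eq_sub_iff_add_eq, ← Finset.sum_union]
  · congr 1
    ext i
    simp only [Finset.mem_union, Finset.mem_filter, le_iff_lt_or_eq]
    tauto
  · rw [Finset.disjoint_filter]
    intro i _ h1 h2
    exact h1.ne h2

/-- A path `u₀ + ∫_(a,t] U dm + ∑_{τ i ≤ t} j i`. -/
def jumpPath (m : Measure ℝ≥0) (a : ℝ≥0) (u₀ : E) (U : ℝ≥0 → E) (I : Finset ℕ) (τ : ℕ → ℝ≥0)
    (j : ℕ → E) (t : ℝ≥0) : E :=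
  u₀ + ∫ s in Ioc a t, U s ∂m + ∑ i ∈ I with τ i ≤ t, j i

variable {m : Measure ℝ≥0} {a : ℝ≥0} {u₀ : E} {U : ℝ≥0 → E} {I : Finset ℕ}
  {τ : ℕ → ℝ≥0} {j : ℕ → E}

lemma jumpPath_bounded (hU : Integrable U m) (t : ℝ≥0) :
    ‖jumpPath m a u₀ U I τ j t‖ ≤ ‖u₀‖ + ∫ s, ‖U s‖ ∂m + ∑ i ∈ I, ‖j i‖ := by
  unfold jumpPath
  refine (norm_add₃_le).trans ?_
  gcongr
  · exact (norm_integral_le_integral_norm _).trans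
      (setIntegral_le_integral hU.norm (Eventually.of_forall fun _ => norm_nonneg _))
  · exact (norm_sum_le _ _).trans
      (Finset.sum_le_sum_of_subset_of_nonneg (Finset.filter_subset _ _) fun _ _ _ => norm_nonneg _)

variable [NullSingletonClass m]

lemma jumpPath_tendsto_left (hU : Integrable U m) (t : ℝ≥0) :
    Tendsto (jumpPath m a u₀ U I τ j) (𝓝[<] t)
      (𝓝 (jumpPath m a u₀ U I τ j t - ∑ i ∈ I with τ i = t, j i)) := by
  have h1 : Tendsto (fun s => u₀ + ∫ r in Ioc a s, U r ∂m) (𝓝[<] t)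
      (𝓝 (u₀ + ∫ r in Ioc a t, U r ∂m)) :=
    ((continuous_const.add (continuous_setIntegral_Ioc hU a)).tendsto t).mono_left
      nhdsWithin_le_nhds
  have h2 := h1.add_const (∑ i ∈ I with τ i ≤ t, j i - ∑ i ∈ I with τ i = t, j i)
  unfold jumpPath
  rw [add_sub_assoc]
  refine h2.congr' ?_
  filter_upwards [sum_jumps_eventually_left I τ j t] with s hs
  rw [hs]

lemma jumpPath_continuousWithinAt_right (hU : Integrable U m) (t : ℝ≥0) :
    ContinuousWithinAt (jumpPath m a u₀ U I τ j) (Ici t) t := by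
  have h1 : Tendsto (fun s => u₀ + ∫ r in Ioc a s, U r ∂m) (𝓝[≥] t)
      (𝓝 (u₀ + ∫ r in Ioc a t, U r ∂m)) :=
    ((continuous_const.add (continuous_setIntegral_Ioc hU a)).tendsto t).mono_left
      nhdsWithin_le_nhds
  have h2 := h1.add_const (∑ i ∈ I with τ i ≤ t, j i)
  refine h2.congr' ?_
  filter_upwards [sum_jumps_eventually_right I τ j t] with s hs
  rw [jumpPath, hs]

lemma jumpPath_stronglyMeasurable (hU : Integrable U m) :
    StronglyMeasurable (jumpPath m a u₀ U I τ j) := by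
  unfold jumpPath
  refine ((continuous_const.add (continuous_setIntegral_Ioc hU a)).stronglyMeasurable).add ?_
  simp_rw [Finset.sum_filter]
  refine Finset.stronglyMeasurable_fun_sum _ fun i _ => ?_
  exact StronglyMeasurable.ite measurableSet_Ici stronglyMeasurable_const stronglyMeasurable_const

lemma integrable_comp_jumpPath [ProperSpace E] (hU : Integrable U m) {X : Type*}
    [NormedAddCommGroup X] {Φ : E → X} (hΦ : Continuous Φ) [IsFiniteMeasure m] :
    Integrable (fun s => Φ (jumpPath m a u₀ U I τ j s)) m := by
  obtain ⟨C, hC⟩ := (isCompact_closedBall (0 : E)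
    (‖u₀‖ + ∫ s, ‖U s‖ ∂m + ∑ i ∈ I, ‖j i‖)).exists_bound_of_continuousOn hΦ.continuousOn
  refine Integrable.of_bound (C := C)
    (hΦ.comp_stronglyMeasurable (jumpPath_stronglyMeasurable hU)).aestronglyMeasurable ?_
  exact Eventually.of_forall fun s => hC _ (by simpa using jumpPath_bounded hU s)

lemma integrable_clm_comp_jumpPath [ProperSpace E] (hU : Integrable U m) {X : Type*}
    [NormedAddCommGroup X] [NormedSpace ℝ X] {Φ : E → E →L[ℝ] X} (hΦ : Continuous Φ) :
    Integrable (fun s => Φ (jumpPath m a u₀ U I τ j s) (U s)) m := by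
  obtain ⟨C, hC⟩ := (isCompact_closedBall (0 : E)
    (‖u₀‖ + ∫ s, ‖U s‖ ∂m + ∑ i ∈ I, ‖j i‖)).exists_bound_of_continuousOn hΦ.continuousOn
  refine Integrable.mono' (hU.norm.const_mul C) ?_ ?_
  · exact isBoundedBilinearMap_apply.continuous.comp_aestronglyMeasurable₂
      (hΦ.comp_stronglyMeasurable (jumpPath_stronglyMeasurable hU)).aestronglyMeasurable
      hU.aestronglyMeasurable
  · refine Eventually.of_forall fun s => ?_
    refine (ContinuousLinearMap.le_opNorm _ _).trans ?_
    gcongr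
    exact hC _ (by simpa using jumpPath_bounded hU s)

/-- The change of variables formula for a path of finite variation whose continuous part is
absolutely continuous with respect to an atomless measure. -/
theorem jumpPath_change_of_variables [ProperSpace E] (hU : Integrable U m)
    (hinj : InjOn τ I) (hτ : ∀ i ∈ I, a < τ i) {F : E → ℝ} (hF : ContDiff ℝ 1 F) {b : ℝ≥0}
    (hab : a ≤ b) :
    F (jumpPath m a u₀ U I τ j b) - F u₀
      = ∫ s in Ioc a b, fderiv ℝ F (jumpPath m a u₀ U I τ j s) (U s) ∂m
        + ∑ i ∈ I with τ i ≤ b, (F (jumpPath m a u₀ U I τ j (τ i))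
            - F (jumpPath m a u₀ U I τ j (τ i) - j i)) := by
  set u := jumpPath m a u₀ U I τ j with hu
  have hF' : Continuous (fderiv ℝ F) := hF.continuous_fderiv one_ne_zero
  have hIint : Integrable (fun s => fderiv ℝ F (u s) (U s)) m :=
    integrable_clm_comp_jumpPath hU hF'
  set w : ℕ → ℝ := fun i => F (u (τ i)) - F (u (τ i) - j i) with hw
  set D : ℝ≥0 → ℝ := fun t => F (u t) - ∫ s in Ioc a t, fderiv ℝ F (u s) (U s) ∂m
    - ∑ i ∈ I with τ i ≤ t, w i with hD
  have hua : u a = u₀ := by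
    have : ∀ i ∈ I, ¬ τ i ≤ a := fun i hi => not_le.2 (hτ i hi)
    simp [hu, jumpPath, Finset.filter_false_of_mem this]
  have hDa : D a = F u₀ := by
    have : ∀ i ∈ I, ¬ τ i ≤ a := fun i hi => not_le.2 (hτ i hi)
    simp [hD, hua, Finset.filter_false_of_mem this]
  have hIcont := continuous_setIntegral_Ioc hIint a
  have hVcont := continuous_setIntegral_Ioc hU.norm a
  -- Each jump of `F ∘ u` cancels the corresponding jump `w i`, and the drift integral is continuous
  -- because `m` has no atoms.
  have hDcont : Continuous D := by
    rw [continuous_iff_continuousAt]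
    intro t
    rw [continuousAt_iff_continuous_left'_right']
    constructor
    -- Injectivity of `τ` leaves at most one jump at `t`. Without it the increments of the nonlinear
    -- `F` would not add up.
    · have hleft : ∑ i ∈ I with τ i = t, w i
          = F (u t) - F (u t - ∑ i ∈ I with τ i = t, j i) := by
        by_cases h : ∃ i ∈ I, τ i = t
        · obtain ⟨i, hi, rfl⟩ := h
          have : I.filter (fun k => τ k = τ i) = {i} := by
            ext k
            simp only [Finset.mem_filter, Finset.mem_singleton]
            exact ⟨fun h => hinj h.1 hi h.2, fun h => by subst h; exact ⟨hi, rfl⟩⟩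
          simp [this, hw]
        · push Not at h
          simp [Finset.filter_false_of_mem h]
      have h1 := (hF.continuous.tendsto _).comp (jumpPath_tendsto_left (a := a) (u₀ := u₀)
        (I := I) (τ := τ) (j := j) hU t)
      have h2 := (h1.sub ((hIcont.tendsto t).mono_left nhdsWithin_le_nhds)).sub_const
        (∑ i ∈ I with τ i ≤ t, w i - ∑ i ∈ I with τ i = t, w i)
      rw [← hu, hleft] at h2
      unfold ContinuousWithinAt
      have e : D t = F (u t - ∑ i ∈ I with τ i = t, j i)
          - ∫ s in Ioc a t, fderiv ℝ F (u s) (U s) ∂m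
          - (∑ i ∈ I with τ i ≤ t, w i - (F (u t) - F (u t - ∑ i ∈ I with τ i = t, j i))) := by
        simp only [hD]; ring
      rw [e]
      refine h2.congr' ?_
      filter_upwards [sum_jumps_eventually_left I τ w t] with s hs
      simp [hD, hs, hleft]
    · rw [continuousWithinAt_Ioi_iff_Ici]
      have h1 : Tendsto (fun s => F (u s)) (𝓝[≥] t) (𝓝 (F (u t))) :=
        (hF.continuous.tendsto _).comp (jumpPath_continuousWithinAt_right hU t)
      have h2 := (h1.sub ((hIcont.tendsto t).mono_left nhdsWithin_le_nhds)).sub_const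
        (∑ i ∈ I with τ i ≤ t, w i)
      refine h2.congr' ?_
      filter_upwards [sum_jumps_eventually_right I τ w t] with s hs
      simp [hD, hs]
  -- Induction along `[a, b]` on a closed condition. Just to the right of `t` there is no jump and
  -- `u` stays close to `u t`. The linearisation of `F` and the freezing of its derivative each cost
  -- `δ ∫ ‖U‖`, hence the factor 2.
  have key : ∀ δ > 0, |D b - D a| ≤ 2 * δ * ∫ s in Ioc a b, ‖U s‖ ∂m := by
    intro δ hδ
    have hsub : Icc a b ⊆ {t | |D t - D a| ≤ 2 * δ * ∫ s in Ioc a t, ‖U s‖ ∂m} := by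
      apply IsClosed.Icc_subset_of_forall_mem_nhdsWithin
      · exact (isClosed_le (by fun_prop) (by fun_prop)).inter isClosed_Icc
      · simp
      · rintro t ⟨ht, hat, htb⟩
        obtain ⟨r, hr, hball⟩ := Metric.continuousAt_iff.1 (hF'.continuousAt (x := u t)) δ hδ
        have hur : ∀ᶠ s in 𝓝[≥] t, dist (u s) (u t) < r :=
          (jumpPath_continuousWithinAt_right hU t).eventually (Metric.ball_mem_nhds _ hr)
        have hall := (hur.and ((sum_jumps_eventually_right I τ w t).and
          (sum_jumps_eventually_right I τ j t)))
        rw [eventually_iff, mem_nhdsGE_iff_exists_Ico_subset] at hall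
        obtain ⟨v, hv, hsubs⟩ := hall
        filter_upwards [Ioo_mem_nhdsGT hv] with t' ht'
        have htt' : t ≤ t' := ht'.1.le
        have hin : ∀ s ∈ Icc t t', dist (u s) (u t) < r := fun s hs =>
          (hsubs ⟨hs.1, hs.2.trans_lt ht'.2⟩).1
        obtain ⟨-, hjw, hjj⟩ := hsubs ⟨htt', ht'.2⟩
        have hsplit : ∀ {X : Type _} [NormedAddCommGroup X] [NormedSpace ℝ X] {f : ℝ≥0 → X},
            Integrable f m → ∫ s in Ioc a t', f s ∂m
              = ∫ s in Ioc a t, f s ∂m + ∫ s in Ioc t t', f s ∂m := by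
          intro X _ _ f hf
          rw [← Ioc_union_Ioc_eq_Ioc hat htt', setIntegral_union]
          · exact Ioc_disjoint_Ioc_of_le le_rfl
          · exact measurableSet_Ioc
          · exact hf.integrableOn
          · exact hf.integrableOn
        have hdu : u t' - u t = ∫ s in Ioc t t', U s ∂m := by
          simp only [hu, jumpPath]
          rw [hjj]
          have : ∫ s in Ioc a t', U s ∂m
              = ∫ s in Ioc a t, U s ∂m + ∫ s in Ioc t t', U s ∂m := by
            rw [← Ioc_union_Ioc_eq_Ioc hat htt', setIntegral_union]
            · exact Ioc_disjoint_Ioc_of_le le_rfl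
            · exact measurableSet_Ioc
            · exact hU.integrableOn
            · exact hU.integrableOn
          rw [this]; abel
        have hdD : D t' - D t = (F (u t') - F (u t))
            - ∫ s in Ioc t t', fderiv ℝ F (u s) (U s) ∂m := by
          simp only [hD]
          rw [hjw, hsplit hIint]; ring
        have hmv : ‖F (u t') - F (u t) - fderiv ℝ F (u t) (u t' - u t)‖
            ≤ δ * ‖u t' - u t‖ := by
          refine Convex.norm_image_sub_le_of_norm_fderiv_le' (s := Metric.ball (u t) r) (𝕜 := ℝ)
            (fun x _ => (hF.differentiable one_ne_zero).differentiableAt) ?_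
            (convex_ball _ _) (Metric.mem_ball_self hr) (hin t' ⟨htt', le_rfl⟩)
          intro x hx
          rw [← dist_eq_norm]
          exact (hball hx).le
        have hnorm : ‖u t' - u t‖ ≤ ∫ s in Ioc t t', ‖U s‖ ∂m := by
          rw [hdu]; exact norm_integral_le_integral_norm _
        have hlin : fderiv ℝ F (u t) (u t' - u t) - ∫ s in Ioc t t', fderiv ℝ F (u s) (U s) ∂m
            = ∫ s in Ioc t t', (fderiv ℝ F (u t) - fderiv ℝ F (u s)) (U s) ∂m := by
          rw [hdu, ← ContinuousLinearMap.integral_comp_comm _ hU.integrableOn,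
            ← integral_sub (ContinuousLinearMap.integrable_comp _ hU.integrableOn)
              hIint.integrableOn]
          rfl
        have hrem : ‖∫ s in Ioc t t', (fderiv ℝ F (u t) - fderiv ℝ F (u s)) (U s) ∂m‖
            ≤ δ * ∫ s in Ioc t t', ‖U s‖ ∂m := by
          rw [← integral_const_mul]
          refine norm_integral_le_of_norm_le (hU.norm.integrableOn.const_mul δ) ?_
          filter_upwards [ae_restrict_mem measurableSet_Ioc] with s hs
          refine (ContinuousLinearMap.le_opNorm _ _).trans ?_
          gcongr
          rw [← dist_eq_norm, dist_comm]
          exact (hball (hin s ⟨hs.1.le, hs.2⟩)).le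
        have hstep : |D t' - D t| ≤ 2 * δ * ∫ s in Ioc t t', ‖U s‖ ∂m := by
          have e : D t' - D t = (F (u t') - F (u t) - fderiv ℝ F (u t) (u t' - u t))
              + ∫ s in Ioc t t', (fderiv ℝ F (u t) - fderiv ℝ F (u s)) (U s) ∂m := by
            rw [← hlin, hdD]; ring
          rw [e]
          refine (abs_add_le _ _).trans ?_
          have := mul_le_mul_of_nonneg_left hnorm hδ.le
          rw [Real.norm_eq_abs] at hmv hrem
          linarith
        change |D t' - D a| ≤ _
        rw [hsplit hU.norm]
        have := abs_sub_le (D t') (D t) (D a)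
        have ht : |D t - D a| ≤ _ := ht
        linarith
    exact hsub ⟨hab, le_rfl⟩
  have hzero : D b - D a = 0 := by
    rw [← abs_nonpos_iff]
    set V := ∫ s in Ioc a b, ‖U s‖ ∂m
    have hV : 0 ≤ V := integral_nonneg fun _ => norm_nonneg _
    refine le_of_forall_pos_le_add fun δ hδ => ?_
    refine (key (δ / (2 * (V + 1))) (by positivity)).trans ?_
    rw [zero_add]
    have : 2 * (δ / (2 * (V + 1))) * V = δ * (V / (V + 1)) := by field_simp
    rw [this]
    exact mul_le_of_le_one_right hδ.le (by rw [div_le_one (by positivity)]; linarith)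
  rw [hDa] at hzero
  simp only [hD] at hzero
  linarith

end JumpPaths

/-! ### The energy inequality for `e^{βA}|y|^p`. -/

section Energy

/-- Since `p > 1`, `|y|^p` is continuously differentiable even at the origin, so for `p < 2` no
regularisation is needed. -/
lemma contDiff_exp_mul_norm_rpow (β : ℝ) {p : ℝ} (hp : 1 < p) :
    ContDiff ℝ 1 fun q : ℝ × ℝ => Real.exp (β * q.1) * ‖q.2‖ ^ p :=
  ((contDiff_const.mul contDiff_fst).exp).mul (contDiff_snd.norm_rpow hp)

lemma fderiv_exp_mul_norm_rpow (β : ℝ) {p : ℝ} (hp : 1 < p) (x : ℝ × ℝ) (v : ℝ) :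
    fderiv ℝ (fun q : ℝ × ℝ => Real.exp (β * q.1) * ‖q.2‖ ^ p) x (1, v)
      = β * (Real.exp (β * x.1) * ‖x.2‖ ^ p)
        + Real.exp (β * x.1) * (p * ‖x.2‖ ^ (p - 2) * x.2 * v) := by
  have h1 : HasFDerivAt (fun q : ℝ × ℝ => Real.exp (β * q.1)) _ x :=
    ((hasFDerivAt_fst (𝕜 := ℝ) (p := x)).const_mul β).exp
  have h2 : HasFDerivAt (fun q : ℝ × ℝ => ‖q.2‖ ^ p) _ x :=
    (hasDerivAt_norm_rpow x.2 hp).comp_hasFDerivAt x (hasFDerivAt_snd (𝕜 := ℝ) (p := x))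
  rw [(h1.fun_mul h2).fderiv]
  simp
  ring

lemma abs_mul_rpow_sub_two {p : ℝ} (hp : 1 < p) (y : ℝ) :
    ‖p * ‖y‖ ^ (p - 2) * y‖ = p * ‖y‖ ^ (p - 1) := by
  rw [norm_mul, norm_mul, Real.norm_of_nonneg (by linarith : (0:ℝ) ≤ p),
    Real.norm_of_nonneg (by positivity : 0 ≤ ‖y‖ ^ (p - 2)), mul_assoc]
  congr 1
  rcases eq_or_ne y 0 with rfl | hy
  · simp [Real.zero_rpow (by linarith : p - 1 ≠ 0)]
  · have : 0 < ‖y‖ := norm_pos_iff.2 hy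
    rw [← Real.rpow_add_one this.ne']
    congr 1; ring

lemma ofReal_exp_mul_norm_rpow (x y : ℝ) {p : ℝ} (hp : 0 ≤ p) :
    ENNReal.ofReal (Real.exp x * ‖y‖ ^ p) = ENNReal.ofReal (Real.exp x) * ‖y‖ₑ ^ p := by
  rw [ENNReal.ofReal_mul (Real.exp_pos _).le, ← ENNReal.ofReal_rpow_of_nonneg (norm_nonneg _) hp,
    ofReal_norm]

/-- The energy inequality satisfied by `e^{βA} |y|^p` along a path with jumps, where
`dy = -G dA + dJ`. -/
theorem energy_inequality {m : Measure ℝ≥0} [IsFiniteMeasure m] [NullSingletonClass m]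
    {a b : ℝ≥0} (hab : a ≤ b) {A y G : ℝ≥0 → ℝ} (hG : Integrable G m)
    (hA : ∀ t ∈ Icc a b, A t = A a + m.real (Ioc a t))
    {I : Finset ℕ} {τ : ℕ → ℝ≥0} {z : ℕ → ℝ} (hinj : InjOn τ I) (hτ : ∀ i ∈ I, τ i ∈ Ioc a b)
    (hy : ∀ t ∈ Icc a b, y t = y a - ∫ s in Ioc a t, G s ∂m + ∑ i ∈ I with τ i ≤ t, z i)
    {p β : ℝ} (hp : 1 < p) (hβ : 0 ≤ β) :
    ENNReal.ofReal β * ∫⁻ s in Ioc a b, ENNReal.ofReal (Real.exp (β * A s)) * ‖y s‖ₑ ^ p ∂m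
        + ∑ i ∈ I, ENNReal.ofReal (Real.exp (β * A (τ i))) * ‖y (τ i)‖ₑ ^ p
      ≤ ENNReal.ofReal (Real.exp (β * A b)) * ‖y b‖ₑ ^ p
        + ∫⁻ s in Ioc a b, ENNReal.ofReal (Real.exp (β * A s))
            * (ENNReal.ofReal p * ‖y s‖ₑ ^ (p - 1) * ‖G s‖ₑ) ∂m
        + ∑ i ∈ I, ENNReal.ofReal (Real.exp (β * A (τ i))) * ‖y (τ i) - z i‖ₑ ^ p := by
  -- The formula is applied to the pair `(A, y)`, so that the weight and the process are
  -- differentiated together. The first coordinate has density 1 and never jumps.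
  set U : ℝ≥0 → ℝ × ℝ := fun s => (1, - G s) with hUdef
  have hU : Integrable U m := (integrable_const (1 : ℝ)).prodMk hG.neg
  set j : ℕ → ℝ × ℝ := fun i => (0, z i) with hj
  set u := jumpPath m a (A a, y a) U I τ j with hu
  have hu_eq : ∀ t ∈ Icc a b, u t = (A t, y t) := by
    intro t ht
    rw [hu, jumpPath, integral_pair (f := fun _ => (1:ℝ)) (g := fun s => - G s)
      (integrable_const _) hG.neg.integrableOn, hA t ht, hy t ht]
    ext
    · simp [hj, Prod.fst_sum, Measure.real]
    · simp [hj, Prod.snd_sum, integral_neg, sub_eq_add_neg]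
  set F : ℝ × ℝ → ℝ := fun q => Real.exp (β * q.1) * ‖q.2‖ ^ p with hF
  have hFc : ContDiff ℝ 1 F := contDiff_exp_mul_norm_rpow β hp
  have ito := jumpPath_change_of_variables (m := m) (a := a) (u₀ := (A a, y a)) (j := j) hU hinj
    (fun i hi => (hτ i hi).1) hFc hab
  rw [← hu, Finset.filter_true_of_mem (fun i hi => (hτ i hi).2), hu_eq b ⟨hab, le_rfl⟩] at ito
  have hF_int : Integrable (fun s => F (u s)) m := integrable_comp_jumpPath hU hFc.continuous
  have hD_int : Integrable (fun s => fderiv ℝ F (u s) (U s)) m :=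
    integrable_clm_comp_jumpPath hU (hFc.continuous_fderiv one_ne_zero)
  set R : ℝ≥0 → ℝ := fun s => Real.exp (β * (u s).1) * (p * ‖(u s).2‖ ^ (p - 2) * (u s).2 * G s)
    with hR
  have hDR : ∀ s, fderiv ℝ F (u s) (U s) = β * F (u s) - R s := by
    intro s
    rw [hF, hUdef]
    simp only [hR]
    rw [fderiv_exp_mul_norm_rpow β hp]
    ring
  have hR_int : Integrable R m := by
    have : R = fun s => β * F (u s) - fderiv ℝ F (u s) (U s) := by
      ext s; rw [hDR]; ring
    rw [this]
    exact (hF_int.const_mul β).sub hD_int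
  have hRn : ∀ s, ‖R s‖ = Real.exp (β * (u s).1) * (p * ‖(u s).2‖ ^ (p - 1) * ‖G s‖) := by
    intro s
    simp only [hR]
    rw [norm_mul, norm_mul (p * ‖(u s).2‖ ^ (p - 2) * (u s).2), abs_mul_rpow_sub_two hp,
      Real.norm_of_nonneg (Real.exp_pos _).le]
  have hFnn : ∀ q, 0 ≤ F q := fun q => mul_nonneg (Real.exp_pos _).le (by positivity)
  have hreal : β * ∫ s in Ioc a b, F (u s) ∂m + ∑ i ∈ I, F (u (τ i))
      ≤ F (A b, y b) + ∫ s in Ioc a b, ‖R s‖ ∂m + ∑ i ∈ I, F (u (τ i) - j i) := by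
    simp_rw [hDR] at ito
    rw [integral_sub (hF_int.integrableOn.const_mul β) hR_int.integrableOn, integral_const_mul,
      Finset.sum_sub_distrib] at ito
    have h1 : ∫ s in Ioc a b, R s ∂m ≤ ∫ s in Ioc a b, ‖R s‖ ∂m :=
      integral_mono hR_int.integrableOn hR_int.norm.integrableOn fun s => le_abs_self _
    -- The energy at the initial time `a` is discarded by positivity.
    have := hFnn (A a, y a)
    linarith
  have key := ENNReal.ofReal_le_ofReal hreal
  have hsum1 : 0 ≤ ∑ i ∈ I, F (u (τ i)) := Finset.sum_nonneg fun _ _ => hFnn _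
  have hsum2 : 0 ≤ ∑ i ∈ I, F (u (τ i) - j i) := Finset.sum_nonneg fun _ _ => hFnn _
  have hint1 : 0 ≤ ∫ s in Ioc a b, F (u s) ∂m := integral_nonneg fun _ => hFnn _
  have hint2 : 0 ≤ ∫ s in Ioc a b, ‖R s‖ ∂m := integral_nonneg fun _ => norm_nonneg _
  rw [ENNReal.ofReal_add (mul_nonneg hβ hint1) hsum1, ENNReal.ofReal_mul hβ,
    ENNReal.ofReal_add (add_nonneg (hFnn _) hint2) hsum2, ENNReal.ofReal_add (hFnn _) hint2,
    ENNReal.ofReal_sum_of_nonneg (fun _ _ => hFnn _),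
    ENNReal.ofReal_sum_of_nonneg (fun _ _ => hFnn _),
    ofReal_integral_eq_lintegral_ofReal hF_int.integrableOn (Eventually.of_forall fun _ => hFnn _),
    ofReal_integral_eq_lintegral_ofReal hR_int.norm.integrableOn
      (Eventually.of_forall fun _ => norm_nonneg _)] at key
  have hp0 : 0 ≤ p := by linarith
  have hFo : ∀ q, ENNReal.ofReal (F q) = ENNReal.ofReal (Real.exp (β * q.1)) * ‖q.2‖ₑ ^ p :=
    fun q => ofReal_exp_mul_norm_rpow _ _ hp0
  have e1 : ∫⁻ s in Ioc a b, ENNReal.ofReal (Real.exp (β * A s)) * ‖y s‖ₑ ^ p ∂m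
      = ∫⁻ s in Ioc a b, ENNReal.ofReal (F (u s)) ∂m := by
    refine setLIntegral_congr_fun measurableSet_Ioc fun s hs => ?_
    rw [hFo, hu_eq s ⟨hs.1.le, hs.2⟩]
  have e2 : ∫⁻ s in Ioc a b, ENNReal.ofReal (Real.exp (β * A s))
      * (ENNReal.ofReal p * ‖y s‖ₑ ^ (p - 1) * ‖G s‖ₑ) ∂m
      = ∫⁻ s in Ioc a b, ENNReal.ofReal ‖R s‖ ∂m := by
    refine setLIntegral_congr_fun measurableSet_Ioc fun s hs => ?_
    rw [hRn, hu_eq s ⟨hs.1.le, hs.2⟩, ENNReal.ofReal_mul (Real.exp_pos _).le,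
      ENNReal.ofReal_mul (by positivity), ENNReal.ofReal_mul hp0, ofReal_norm,
      ← ENNReal.ofReal_rpow_of_nonneg (norm_nonneg _) (by linarith), ofReal_norm]
  have e3 : ∑ i ∈ I, ENNReal.ofReal (Real.exp (β * A (τ i))) * ‖y (τ i)‖ₑ ^ p
      = ∑ i ∈ I, ENNReal.ofReal (F (u (τ i))) := by
    refine Finset.sum_congr rfl fun i hi => ?_
    rw [hFo, hu_eq _ ⟨(hτ i hi).1.le, (hτ i hi).2⟩]
  have e4 : ∑ i ∈ I, ENNReal.ofReal (Real.exp (β * A (τ i))) * ‖y (τ i) - z i‖ₑ ^ p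
      = ∑ i ∈ I, ENNReal.ofReal (F (u (τ i) - j i)) := by
    refine Finset.sum_congr rfl fun i hi => ?_
    rw [hFo, hu_eq _ ⟨(hτ i hi).1.le, (hτ i hi).2⟩]
    simp [hj]
  rw [e1, e2, e3, e4, ← hFo (A b, y b)]
  exact key

end Energy

/-! ### Elementary inequalities and the choice of constants. -/

section Inequalities

lemma one_div_rpow_mem_Ioo {p ε : ℝ} (hp : 1 < p) (hε : 0 < ε) :
    (1 / (1 + ε)) ^ (1 / (p - 1)) ∈ Ioo (0 : ℝ) 1 := by
  have : 0 < p - 1 := by linarith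
  refine ⟨by positivity, Real.rpow_lt_one (by positivity) ?_ (by positivity)⟩
  rw [div_lt_one (by positivity)]; linarith

lemma cEps_nonneg {p ε : ℝ} (hp : 1 < p) (hε : 0 < ε) : 0 ≤ cEps p ε :=
  Real.rpow_nonneg (by linarith [(one_div_rpow_mem_Ioo hp hε).2]) _

/-- Convexity of `x^p` at `l · (s/l) + (1 - l) · (t/(1 - l))`. -/
lemma add_rpow_le_weighted {p l s t : ℝ} (hp : 1 < p) (hl : l ∈ Ioo (0 : ℝ) 1) (hs : 0 ≤ s)
    (ht : 0 ≤ t) : (s + t) ^ p ≤ l ^ (1 - p) * s ^ p + (1 - l) ^ (1 - p) * t ^ p := by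
  have h1 : 0 < 1 - l := by linarith [hl.2]
  have h0 := hl.1
  have h := (convexOn_rpow hp.le).2 (x := s / l) (y := t / (1 - l))
    (show 0 ≤ s / l by positivity) (show 0 ≤ t / (1 - l) by positivity) h0.le h1.le (by ring)
  simp only [smul_eq_mul] at h
  rw [mul_div_cancel₀ _ h0.ne', mul_div_cancel₀ _ h1.ne', Real.div_rpow hs h0.le,
    Real.div_rpow ht h1.le] at h
  refine h.trans_eq ?_
  rw [Real.rpow_sub h0, Real.rpow_sub h1, Real.rpow_one, Real.rpow_one]
  ring

/-- Write `z = (y + z) - y` and use the weight `l = (1+ε)^{-1/(p-1)}`. It is chosen so that `l^{1-p}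
= 1 + ε`, and then `(1-l)^{1-p}` is `cEps p ε`. -/
lemma enorm_rpow_le_cEps {p ε : ℝ} (hp : 1 < p) (hε : 0 < ε) (y z : ℝ) :
    ‖z‖ₑ ^ p ≤ ENNReal.ofReal (1 + ε) * ‖y + z‖ₑ ^ p + ENNReal.ofReal (cEps p ε) * ‖y‖ₑ ^ p := by
  have hp0 : 0 ≤ p := by linarith
  have hp1 : p - 1 ≠ 0 := by linarith
  have hl := one_div_rpow_mem_Ioo hp hε
  have h := add_rpow_le_weighted hp hl (norm_nonneg (y + z)) (norm_nonneg y)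
  have e : ((1 / (1 + ε)) ^ (1 / (p - 1))) ^ (1 - p) = 1 + ε := by
    rw [← Real.rpow_mul (by positivity), show 1 / (p - 1) * (1 - p) = -1 by field_simp; ring,
      Real.rpow_neg_one, one_div, inv_inv]
  rw [e] at h
  have hz : ‖z‖ ^ p ≤ (1 + ε) * ‖y + z‖ ^ p + cEps p ε * ‖y‖ ^ p := by
    refine le_trans (Real.rpow_le_rpow (norm_nonneg _) ?_ hp0) h
    have := norm_sub_le (y + z) y
    simpa using this
  have hofReal := ENNReal.ofReal_le_ofReal hz
  rwa [ENNReal.ofReal_add (by positivity) (mul_nonneg (cEps_nonneg hp hε) (by positivity)),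
    ENNReal.ofReal_mul (by positivity), ENNReal.ofReal_mul (cEps_nonneg hp hε),
    ← ENNReal.ofReal_rpow_of_nonneg (norm_nonneg _) hp0,
    ← ENNReal.ofReal_rpow_of_nonneg (norm_nonneg _) hp0,
    ← ENNReal.ofReal_rpow_of_nonneg (norm_nonneg _) hp0, ofReal_norm, ofReal_norm,
    ofReal_norm] at hofReal

/-- Young's inequality with a parameter. -/
lemma young_weighted {p R : ℝ} (hp : 1 < p) (hR : 0 < R) (a b : ℝ≥0∞) :
    ENNReal.ofReal p * b ^ (p - 1) * a
      ≤ ENNReal.ofReal (1 / R) * a ^ p + ENNReal.ofReal ((p - 1) * R ^ (1 / (p - 1))) * b ^ p := by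
  have hp0 : 0 < p := by linarith
  have hp1 : 0 < p - 1 := by linarith
  -- The scalings satisfy `r⁻¹ · c^{p-1} = 1`, so they leave the product unchanged, while `r^{-p} =
  -- 1/R` and `c^p = R^{1/(p-1)}` give the two coefficients.
  set r := R ^ (1 / p) with hr
  have hr0 : 0 < r := by positivity
  set c := R ^ (1 / (p * (p - 1))) with hc
  have hc0 : 0 < c := by positivity
  have hpq : p.HolderConjugate (p / (p - 1)) := Real.HolderConjugate.conjExponent hp
  have hcr : c ^ (p - 1) = r := by
    rw [hc, hr, ← Real.rpow_mul hR.le]; congr 1; field_simp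
  have hcp : c ^ p = R ^ (1 / (p - 1)) := by
    rw [hc, ← Real.rpow_mul hR.le]; congr 1; field_simp
  have hrp : (1 / r) ^ p = 1 / R := by
    rw [hr, Real.div_rpow zero_le_one (by positivity), ← Real.rpow_mul hR.le]
    simp [hp0.ne']
  have key := ENNReal.young_inequality (ENNReal.ofReal (1 / r) * a)
    ((ENNReal.ofReal c * b) ^ (p - 1)) hpq
  have e1 : (ENNReal.ofReal (1 / r) * a) * (ENNReal.ofReal c * b) ^ (p - 1) = b ^ (p - 1) * a := by
    rw [ENNReal.mul_rpow_of_nonneg _ _ hp1.le, ENNReal.ofReal_rpow_of_nonneg hc0.le hp1.le, hcr]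
    have : ENNReal.ofReal (1 / r) * ENNReal.ofReal r = 1 := by
      rw [← ENNReal.ofReal_mul (by positivity), one_div_mul_cancel hr0.ne', ENNReal.ofReal_one]
    calc _ = (ENNReal.ofReal (1 / r) * ENNReal.ofReal r) * (b ^ (p - 1) * a) := by ring
      _ = _ := by rw [this, one_mul]
  have e2 : (ENNReal.ofReal (1 / r) * a) ^ p = ENNReal.ofReal (1 / R) * a ^ p := by
    rw [ENNReal.mul_rpow_of_nonneg _ _ hp0.le,
      ENNReal.ofReal_rpow_of_nonneg (by positivity) hp0.le, hrp]
  have e3 : ((ENNReal.ofReal c * b) ^ (p - 1)) ^ (p / (p - 1))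
      = ENNReal.ofReal (R ^ (1 / (p - 1))) * b ^ p := by
    rw [← ENNReal.rpow_mul, mul_div_cancel₀ _ hp1.ne', ENNReal.mul_rpow_of_nonneg _ _ hp0.le,
      ENNReal.ofReal_rpow_of_nonneg hc0.le hp0.le, hcp]
  rw [e1, e2, e3] at key
  have hpne : ENNReal.ofReal p ≠ 0 := by simpa using hp0
  calc _ = ENNReal.ofReal p * (b ^ (p - 1) * a) := by ring
    _ ≤ _ := mul_le_mul_right key (ENNReal.ofReal p)
    _ = _ := by
      rw [mul_add, ENNReal.mul_div_cancel hpne ENNReal.ofReal_ne_top,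
        div_eq_mul_inv (ENNReal.ofReal (R ^ (1 / (p - 1))) * b ^ p),
        ← ENNReal.ofReal_inv_of_pos (by positivity), ENNReal.ofReal_mul hp1.le]
      congr 1
      calc _ = (ENNReal.ofReal p * ENNReal.ofReal (p / (p - 1))⁻¹)
              * ENNReal.ofReal (R ^ (1 / (p - 1))) * b ^ p := by ring
        _ = _ := by
          rw [← ENNReal.ofReal_mul hp0.le]
          congr 3
          field_simp

/-- The pointwise estimate of the driver term. -/
lemma driver_bound {K : Type*} [MeasurableSpace K] (φ : Measure K) [IsProbabilityMeasure φ]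
    {p R₀ R₁ : ℝ} (hp : 1 < p) (hR₀ : 0 < R₀) (hR₁ : 0 < R₁) (L L' : ℝ≥0) {y Zp G : ℝ≥0∞}
    (hy : y ≠ ∞) {h : K → ℝ≥0∞}
    (hG : G ≤ L' * y + L * Zp ^ (1 / p) + ∫⁻ x, h x ∂φ) :
    ENNReal.ofReal p * y ^ (p - 1) * G
      ≤ (ENNReal.ofReal (p * L') + ENNReal.ofReal ((p - 1) * R₀ ^ (1 / (p - 1)))
          + ENNReal.ofReal ((p - 1) * R₁ ^ (1 / (p - 1)))) * y ^ p
        + ENNReal.ofReal (L ^ p / R₀) * Zp + ENNReal.ofReal (1 / R₁) * ∫⁻ x, h x ^ p ∂φ := by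
  have hp0 : 0 < p := by linarith
  have hp1 : 0 < p - 1 := by linarith
  have h1 : ENNReal.ofReal p * y ^ (p - 1) * (L' * y) = ENNReal.ofReal (p * L') * y ^ p := by
    rw [ENNReal.ofReal_mul hp0.le, ENNReal.ofReal_coe_nnreal]
    have : y ^ p = y ^ (p - 1) * y := by
      conv_lhs => rw [show p = (p - 1) + 1 by ring]
      rw [ENNReal.rpow_add_of_nonneg _ _ hp1.le zero_le_one, ENNReal.rpow_one]
    rw [this]; ring
  have h2 := young_weighted hp hR₀ (L * Zp ^ (1 / p)) y
  have e2 : ENNReal.ofReal (1 / R₀) * (L * Zp ^ (1 / p)) ^ p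
      = ENNReal.ofReal (L ^ p / R₀) * Zp := by
    rw [ENNReal.mul_rpow_of_nonneg _ _ hp0.le, ← ENNReal.rpow_mul, one_div_mul_cancel hp0.ne',
      ENNReal.rpow_one, ← mul_assoc]
    congr 1
    rw [← ENNReal.ofReal_coe_nnreal, ENNReal.ofReal_rpow_of_nonneg L.coe_nonneg hp0.le,
      ← ENNReal.ofReal_mul (by positivity)]
    congr 1
    ring
  rw [e2] at h2
  -- Young is applied under the integral, and `φ` has mass one, so Jensen's inequality is not
  -- needed. Finiteness of `y` lets the factor enter the integral although `h` need not be
  -- measurable.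
  have h3 : ENNReal.ofReal p * y ^ (p - 1) * ∫⁻ x, h x ∂φ
      ≤ ENNReal.ofReal (1 / R₁) * ∫⁻ x, h x ^ p ∂φ
        + ENNReal.ofReal ((p - 1) * R₁ ^ (1 / (p - 1))) * y ^ p := by
    rw [← lintegral_const_mul' _ _ (ENNReal.mul_ne_top ENNReal.ofReal_ne_top
      (ENNReal.rpow_ne_top_of_nonneg hp1.le hy))]
    refine (lintegral_mono fun x => young_weighted hp hR₁ (h x) y).trans_eq ?_
    rw [lintegral_add_right _ measurable_const, lintegral_const_mul' _ _ ENNReal.ofReal_ne_top]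
    simp
  calc _ ≤ ENNReal.ofReal p * y ^ (p - 1) * (L' * y + L * Zp ^ (1 / p) + ∫⁻ x, h x ∂φ) := by gcongr
    _ = ENNReal.ofReal p * y ^ (p - 1) * (L' * y)
        + ENNReal.ofReal p * y ^ (p - 1) * (L * Zp ^ (1 / p))
        + ENNReal.ofReal p * y ^ (p - 1) * ∫⁻ x, h x ∂φ := by ring
    _ ≤ _ := add_le_add (add_le_add h1.le h2) h3
    _ = _ := by ring

lemma betaBound_nonneg {p ε L L' : ℝ} (hp : 1 < p) (hε : 0 < ε) (hL : 0 ≤ L) (hL' : 0 ≤ L') :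
    0 ≤ betaBound p ε L L' := by
  have := cEps_nonneg hp hε
  have : 0 ≤ p - 1 := by linarith
  have : 0 ≤ p := by linarith
  unfold betaBound
  positivity

/-- Constants with which the a priori estimate closes: `a`, `b` and `q` stand for the weighted
energies of `Y`, `Z` and `Y + Z`, and `X`, `H` for those of the data. -/
structure IsAprioriConstant (p ε β : ℝ) (L L' : ℝ≥0) (R₀ R₁ : ℝ) (C : ℝ≥0) : Prop where
  pos₀ : 0 < R₀
  pos₁ : 0 < R₁
  absorb : ∀ a b q X H : ℝ≥0∞, a ≠ ∞ → b ≠ ∞ →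
      ENNReal.ofReal β * a + q ≤ X
        + ((ENNReal.ofReal (p * L') + ENNReal.ofReal ((p - 1) * R₀ ^ (1 / (p - 1)))
          + ENNReal.ofReal ((p - 1) * R₁ ^ (1 / (p - 1)))) * a
          + ENNReal.ofReal (L ^ p / R₀) * b + ENNReal.ofReal (1 / R₁) * H) + a →
      b ≤ ENNReal.ofReal (1 + ε) * q + ENNReal.ofReal (cEps p ε) * a →
      a + b ≤ C * (X + H)

lemma exists_isAprioriConstant {p ε β : ℝ} {L L' : ℝ≥0} (hp : 1 < p) (hε : 0 < ε)
    (hβ : betaBound p ε L L' < β) :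
    ∃ (R₀ R₁ : ℝ) (C : ℝ≥0), IsAprioriConstant p ε β L L' R₀ R₁ C := by
  have hp0 : 0 < p := by linarith
  have hp1 : 0 < p - 1 := by linarith
  have hLnn : (0 : ℝ) ≤ L := L.2
  have hL'nn : (0 : ℝ) ≤ L' := L'.2
  have hc := cEps_nonneg hp hε
  -- With `L + 1` in place of `L`, `R₀` is positive even for `L = 0` and `L^p / R₀ < 1/(1+ε)` is
  -- strict, which leaves the coefficient `d > 0` for `b`.
  set R₀ : ℝ := ((L : ℝ) + 1) ^ p * (1 + ε) with hR₀
  have hR₀pos : 0 < R₀ := by positivity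
  -- Half of the slack in `β` pays for the source, through the choice of `R₁`. The other half
  -- survives as the coefficient of `a`.
  set η : ℝ := (β - betaBound p ε L L') / 2 with hη
  have hηpos : 0 < η := by rw [hη]; linarith
  set R₁ : ℝ := (η / (p - 1)) ^ (p - 1) with hR₁
  have hR₁pos : 0 < R₁ := by positivity
  have hR₁η : (p - 1) * R₁ ^ (1 / (p - 1)) = η := by
    rw [hR₁, ← Real.rpow_mul (by positivity), mul_one_div_cancel hp1.ne', Real.rpow_one]
    field_simp
  have hbb : betaBound p ε L L'
      = 1 + cEps p ε / (1 + ε) + p * L' + (p - 1) * R₀ ^ (1 / (p - 1)) := rfl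
  set κ := (p - 1) * R₀ ^ (1 / (p - 1)) with hκ
  have hκnn : 0 ≤ κ := by positivity
  have hcd : 0 ≤ cEps p ε / (1 + ε) := by positivity
  have hβpos : 0 ≤ β := (betaBound_nonneg hp hε hLnn hL'nn).trans hβ.le
  set d : ℝ := 1 / (1 + ε) - L ^ p / R₀ with hd
  have hdpos : 0 < d := by
    have h : (L : ℝ) ^ p < ((L : ℝ) + 1) ^ p := Real.rpow_lt_rpow hLnn (by linarith) hp0
    rw [hd, hR₀, sub_pos, div_lt_div_iff₀ (by positivity) (by positivity)]
    nlinarith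
  set μ := min η d with hμ
  have hμpos : 0 < μ := lt_min hηpos hdpos
  set C : ℝ := max 1 (1 / R₁) / μ with hC
  have hCpos : 0 < C := by
    have : 0 < max 1 (1 / R₁) := lt_max_of_lt_left one_pos
    positivity
  refine ⟨R₀, R₁, C.toNNReal, hR₀pos, hR₁pos, ?_⟩
  intro a b q X H ha hb h1 h2
  rw [hR₁η] at h1
  by_cases hXH : X + H = ∞
  · rw [hXH, ENNReal.mul_top]
    · exact le_top
    · simpa using hCpos
  obtain ⟨hX, hH⟩ := ENNReal.add_ne_top.1 hXH
  have hrhs : X + ((ENNReal.ofReal (p * L') + ENNReal.ofReal κ + ENNReal.ofReal η) * a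
          + ENNReal.ofReal (L ^ p / R₀) * b + ENNReal.ofReal (1 / R₁) * H) + a ≠ ∞ := by
    finiteness
  -- Finiteness of `q` is a consequence of the inequality itself; from here on everything is real
  -- arithmetic.
  have hq : q ≠ ∞ := ne_top_of_le_ne_top hrhs (le_add_self.trans h1)
  lift a to ℝ≥0 using ha
  lift b to ℝ≥0 using hb
  lift q to ℝ≥0 using hq
  lift X to ℝ≥0 using hX
  lift H to ℝ≥0 using hH
  simp only [ENNReal.ofReal] at h1 h2
  norm_cast at h1 h2 ⊢
  rw [← NNReal.coe_le_coe] at h1 h2 ⊢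
  push_cast [Real.coe_toNNReal'] at h1 h2 ⊢
  have hpL : 0 ≤ p * L' := by positivity
  rw [max_eq_left hβpos, max_eq_left hpL, max_eq_left hκnn, max_eq_left hηpos.le,
    max_eq_left (by positivity : 0 ≤ (L : ℝ) ^ p / R₀), max_eq_left (by positivity : 0 ≤ 1 / R₁)]
    at h1
  rw [max_eq_left (by positivity : 0 ≤ 1 + ε), max_eq_left hc] at h2
  rw [max_eq_left hCpos.le]
  have h2' : (b : ℝ) / (1 + ε) - cEps p ε / (1 + ε) * a ≤ q := by
    have : (b : ℝ) / (1 + ε) ≤ ((1 + ε) * q + cEps p ε * a) / (1 + ε) := by gcongr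
    have e : ((1 + ε) * q + cEps p ε * a) / (1 + ε) = q + cEps p ε / (1 + ε) * a := by
      field_simp
    linarith
  have ha0 : (0 : ℝ) ≤ a := a.2
  have hb0 : (0 : ℝ) ≤ b := b.2
  have hX0 : (0 : ℝ) ≤ X := X.2
  have hH0 : (0 : ℝ) ≤ H := H.2
  have h3 : η * a + d * b ≤ X + 1 / R₁ * H := by
    have e1 : β = 2 * η + betaBound p ε L L' := by rw [hη]; ring
    have e2 : d * b = (b : ℝ) / (1 + ε) - L ^ p / R₀ * b := by rw [hd]; ring
    rw [e1, hbb] at h1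
    rw [e2]
    nlinarith
  have h4 : μ * (a + b) ≤ max 1 (1 / R₁) * (X + H) := by
    have i1 : μ * a ≤ η * a := mul_le_mul_of_nonneg_right (min_le_left _ _) ha0
    have i2 : μ * b ≤ d * b := mul_le_mul_of_nonneg_right (min_le_right _ _) hb0
    have i3 : 1 * (X : ℝ) ≤ max 1 (1 / R₁) * X := mul_le_mul_of_nonneg_right (le_max_left _ _) hX0
    have i4 : 1 / R₁ * (H : ℝ) ≤ max 1 (1 / R₁) * H :=
      mul_le_mul_of_nonneg_right (le_max_right _ _) hH0
    nlinarith
  rw [hC, div_mul_eq_mul_div, le_div_iff₀ hμpos]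
  linarith

end Inequalities

/-! ### Predictability of stochastic intervals and of left limits. -/

namespace MarkedPointProcess

variable {Ω : Type*} [mΩ : MeasurableSpace Ω] {P : Measure Ω}
  {K : Type*} [mK : MeasurableSpace K] {T : ℝ≥0}

section Predictable

variable (N : MarkedPointProcess P K T)

lemma measurable_time : Measurable[N.predictableSigma] (Prod.fst : ℝ≥0 × Ω → ℝ≥0) := by
  refine measurable_of_Ioi fun i => ?_
  have : (Prod.fst : ℝ≥0 × Ω → ℝ≥0) ⁻¹' Ioi i = Ioi i ×ˢ (univ : Set Ω) := by ext; simp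
  rw [this]
  exact measurableSet_predictable_Ioi_prod MeasurableSet.univ

/-- The stochastic interval `(S k, T]`. -/
def afterJump (k : ℕ) : Set (ℝ≥0 × Ω) := {q | N.S k q.2 < q.1 ∧ q.1 ≤ T}

/-- A rational strictly between `S k` and the current time gives a countable union of predictable
rectangles. Index 0 is separate because the filtration is generated by the indices `n ≥ 1` only. -/
lemma measurableSet_S_lt (k : ℕ) :
    MeasurableSet[N.predictableSigma] {q : ℝ≥0 × Ω | N.S k q.2 < q.1} := by
  rcases Nat.eq_zero_or_pos k with rfl | hk
  · simp_rw [N.S_zero]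
    have : {q : ℝ≥0 × Ω | (0 : ℝ≥0∞) < q.1} = Prod.fst ⁻¹' Ioi 0 := by ext; simp
    rw [this]
    exact N.measurable_time measurableSet_Ioi
  · have : {q : ℝ≥0 × Ω | N.S k q.2 < q.1}
        = ⋃ r : ℚ, Ioi (Real.toNNReal r) ×ˢ {ω | N.S k ω ≤ Real.toNNReal r} := by
      ext ⟨t, ω⟩
      simp only [mem_ofPred_eq, mem_iUnion, mem_prod, mem_Ioi]
      constructor
      · intro h
        obtain ⟨r, -, h1, h2⟩ := ENNReal.lt_iff_exists_rat_btwn.1 h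
        exact ⟨r, by exact_mod_cast h2, h1.le⟩
      · rintro ⟨r, h1, h2⟩
        exact h2.trans_lt (by exact_mod_cast h1)
    rw [this]
    refine MeasurableSet.iUnion fun r => measurableSet_predictable_Ioi_prod ?_
    exact MeasurableSpace.measurableSet_generateFrom
      ⟨k, hk, Real.toNNReal r, le_rfl, univ, MeasurableSet.univ, by simp⟩

lemma measurableSet_afterJump (k : ℕ) : MeasurableSet[N.predictableSigma] (N.afterJump k) :=
  (N.measurableSet_S_lt k).inter (N.measurable_time measurableSet_Iic)

/-- The left limits of a process on `(0, T]`. -/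
def leftValue (T : ℝ≥0) (Y : ℝ≥0 → Ω → ℝ) (q : ℝ≥0 × Ω) : ℝ :=
  if q.1 ∈ Ioc 0 T then Function.leftLim (fun s => Y s q.2) q.1 else 0

/-- The index `⌈s(n+1)⌉ - 1` gives the last lattice point strictly before `s`; strictness makes the
samples converge to the left limit. -/
lemma nnreal_lattice_mem (n : ℕ) {s : ℝ≥0} (hs : 0 < s) :
    s ∈ Ioc (((⌈s * (n + 1)⌉₊ - 1 : ℕ) : ℝ≥0) / (n + 1))
      ((((⌈s * (n + 1)⌉₊ - 1 : ℕ) : ℝ≥0) + 1) / (n + 1)) := by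
  have hn : (0 : ℝ≥0) < n + 1 := by positivity
  have hpos : 0 < ⌈s * (n + 1)⌉₊ := Nat.ceil_pos.2 (mul_pos hs hn)
  have hcast : (((⌈s * (n + 1)⌉₊ - 1 : ℕ) : ℝ≥0) + 1) = ⌈s * (n + 1)⌉₊ := by
    exact_mod_cast Nat.sub_add_cancel hpos
  constructor
  · rw [div_lt_iff₀ hn]
    exact Nat.lt_ceil.1 (Nat.sub_lt hpos one_pos)
  · rw [hcast, le_div_iff₀ hn]
    exact Nat.le_ceil _

lemma nnreal_lattice_eq (n k : ℕ) {s : ℝ≥0}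
    (hs : s ∈ Ioc ((k : ℝ≥0) / (n + 1)) (((k : ℝ≥0) + 1) / (n + 1))) :
    ⌈s * (n + 1)⌉₊ - 1 = k := by
  have hn : (0 : ℝ≥0) < n + 1 := by positivity
  rw [mem_Ioc, div_lt_iff₀ hn, le_div_iff₀ hn] at hs
  have : ⌈s * (n + 1)⌉₊ = k + 1 := by
    rw [Nat.ceil_eq_iff (by omega)]
    simpa using hs
  omega

lemma tendsto_lattice_left {s : ℝ≥0} (hs : 0 < s) :
    Tendsto (fun n : ℕ => ((⌈s * (n + 1)⌉₊ - 1 : ℕ) : ℝ≥0) / (n + 1)) atTop (𝓝[<] s) := by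
  apply tendsto_nhdsWithin_of_tendsto_nhds_of_eventually_within
  · have h1 : Tendsto (fun n : ℕ => s - 1 / ((n : ℝ≥0) + 1)) atTop (𝓝 s) := by
      have : Tendsto (fun n : ℕ => 1 / ((n : ℝ≥0) + 1)) atTop (𝓝 0) :=
        tendsto_one_div_add_atTop_nhds_zero_nat
      simpa using tendsto_const_nhds.sub this
    refine tendsto_of_tendsto_of_tendsto_of_le_of_le h1 tendsto_const_nhds ?_ ?_
    · intro n
      have := (nnreal_lattice_mem n hs).2
      rw [add_div] at this
      exact tsub_le_iff_right.2 this
    · exact fun n => (nnreal_lattice_mem n hs).1.le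
  · exact Eventually.of_forall fun n => (nnreal_lattice_mem n hs).1

/-- The left limit is the limit of `Y` sampled at the last lattice point before `s`, and each
sampled process is constant in time on predictable strips. -/
lemma measurable_leftValue {Y : ℝ≥0 → Ω → ℝ}
    (hY : ∀ t ≤ T, Measurable[N.filtration t] (Y t))
    (hl : ∀ ω, ∀ t ≤ T, ∃ l, Tendsto (fun s => Y s ω) (𝓝[<] t) (𝓝 l)) :
    Measurable[N.predictableSigma] (leftValue T Y) := by
  have hY' : ∀ t, Measurable[N.filtration t] (Y (min t T)) := fun t =>
    (hY _ (min_le_right _ _)).mono (N.filtration.mono (min_le_left _ _)) le_rfl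
  let W : ℕ → ℝ≥0 × Ω → ℝ := fun n q =>
    Y (min (((⌈q.1 * (n + 1)⌉₊ - 1 : ℕ) : ℝ≥0) / (n + 1)) T) q.2
  have hW : ∀ n, Measurable[N.predictableSigma] (W n) := by
    intro n B hB
    -- At `s = 0` the truncated subtraction yields the lattice point 0, so time 0 contributes a
    -- rectangle of its own.
    have : W n ⁻¹' B = ({⊥} ×ˢ (Y (min 0 T) ⁻¹' B)) ∪ ⋃ k : ℕ,
        Ioc ((k : ℝ≥0) / (n + 1)) (((k : ℝ≥0) + 1) / (n + 1))
          ×ˢ (Y (min ((k : ℝ≥0) / (n + 1)) T) ⁻¹' B) := by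
      ext ⟨s, ω⟩
      simp only [mem_preimage, mem_union, mem_prod, mem_singleton_iff, mem_iUnion, W]
      rcases eq_or_lt_of_le (zero_le : 0 ≤ s) with rfl | hs
      · simp
      · have hs' : s ≠ ⊥ := hs.ne'
        simp only [hs', false_and, false_or]
        constructor
        · intro h
          exact ⟨_, nnreal_lattice_mem n hs, h⟩
        · rintro ⟨k, hk, h⟩
          rwa [nnreal_lattice_eq n k hk]
    rw [this]
    refine MeasurableSet.union ?_ (MeasurableSet.iUnion fun k => ?_)
    · exact measurableSet_predictable_singleton_bot_prod (hY' 0 hB)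
    · exact measurableSet_predictable_Ioc_prod _ _ (hY' _ hB)
  have hset : MeasurableSet[N.predictableSigma] {q : ℝ≥0 × Ω | q.1 ∈ Ioc 0 T} :=
    N.measurable_time measurableSet_Ioc
  refine @measurable_of_tendsto_metrizable _ _ N.predictableSigma _ _ _ _
    (fun n q => if q.1 ∈ Ioc 0 T then W n q else 0) _
    (fun n => Measurable.ite hset (hW n) measurable_const) ?_
  rw [tendsto_pi_nhds]
  rintro ⟨s, ω⟩
  by_cases hs : s ∈ Ioc 0 T
  · simp only [leftValue, hs, if_true]
    have hlim : Tendsto (fun r => Y r ω) (𝓝[<] s) (𝓝 (Function.leftLim (fun r => Y r ω) s)) :=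
      tendsto_leftLim_of_tendsto (hl ω s hs.2)
    refine (hlim.comp (tendsto_lattice_left hs.1)).congr fun n => ?_
    simp only [W, Function.comp_apply]
    rw [min_eq_left ((nnreal_lattice_mem n hs.1).1.le.trans hs.2)]
  · simp [leftValue, hs]

end Predictable

/-! ### The counting measure as a finite sum of point masses. -/

section JumpMeasure

variable (N : MarkedPointProcess P K T)

lemma S_monotone (ω : Ω) : Monotone fun n => N.S n ω :=
  monotone_nat_of_le_succ fun n => N.S_mono n ω

/-- The times of the counting measure. -/
def jumpTime (ω : Ω) (n : ℕ) : ℝ≥0 := (N.S (n + 1) ω).toNNReal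

lemma finite_jumps (ω : Ω) : {n | N.S (n + 1) ω ≤ T}.Finite := by
  obtain ⟨M, hM⟩ := N.non_explosive ω
  refine (finite_lt_nat M).subset fun n hn => ?_
  by_contra h
  exact absurd (N.S_monotone ω (show M ≤ n + 1 by simp at h; omega)) (not_le.2 (hn.trans_lt hM))

/-- The indices of the jumps up to the horizon. -/
def jumpIndices (ω : Ω) : Finset ℕ := (N.finite_jumps ω).toFinset

lemma mem_jumpIndices {ω : Ω} {n : ℕ} : n ∈ N.jumpIndices ω ↔ N.S (n + 1) ω ≤ T := by
  simp [jumpIndices]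

lemma coe_jumpTime {ω : Ω} {n : ℕ} (hn : n ∈ N.jumpIndices ω) :
    (N.jumpTime ω n : ℝ≥0∞) = N.S (n + 1) ω :=
  ENNReal.coe_toNNReal (ne_top_of_le_ne_top ENNReal.coe_ne_top (N.mem_jumpIndices.1 hn))

lemma jumpTime_mem {ω : Ω} {n : ℕ} (hn : n ∈ N.jumpIndices ω) : N.jumpTime ω n ∈ Ioc 0 T := by
  have h1 := N.S_pos (n + 1) (by omega) ω
  have h2 := N.mem_jumpIndices.1 hn
  rw [← N.coe_jumpTime hn] at h1 h2
  exact ⟨by exact_mod_cast h1, by exact_mod_cast h2⟩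

lemma jumpTime_injOn {ω : Ω} (h : ∀ n, N.S n ω ≤ T → N.S n ω < N.S (n + 1) ω) :
    InjOn (N.jumpTime ω) (N.jumpIndices ω) := by
  have aux : ∀ i ∈ N.jumpIndices ω, ∀ k ∈ N.jumpIndices ω, i < k →
      N.jumpTime ω i < N.jumpTime ω k := by
    intro i hi k hk hik
    rw [← ENNReal.coe_lt_coe, N.coe_jumpTime hi, N.coe_jumpTime hk]
    exact (h (i + 1) (N.mem_jumpIndices.1 hi)).trans_le (N.S_monotone ω (by omega))
  intro i hi k hk hik
  rcases lt_trichotomy i k with hlt | rfl | hlt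
  · exact absurd hik (aux i hi k hk hlt).ne
  · rfl
  · exact absurd hik (aux k hk i hi hlt).ne'

lemma jumpMeasure_eq (ω : Ω) : N.jumpMeasure ω
    = ∑ n ∈ N.jumpIndices ω, Measure.dirac (N.jumpTime ω n, N.X (n + 1) ω) := by
  classical
  ext B hB
  rw [jumpMeasure, Measure.sum_apply _ hB, Measure.finsetSum_apply, tsum_eq_sum]
  · refine Finset.sum_congr rfl fun n hn => ?_
    rw [if_pos (N.mem_jumpIndices.1 hn)]
    rfl
  · intro n hn
    rw [if_neg (fun h => hn (N.mem_jumpIndices.2 h))]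
    simp

variable [MeasurableSingletonClass K]

/-- Non-explosion makes the sum finite, and measurable singletons free the integrand from any
measurability condition. -/
lemma lintegral_jumpMeasure (ω : Ω) (f : ℝ≥0 × K → ℝ≥0∞) : ∫⁻ q, f q ∂(N.jumpMeasure ω)
    = ∑ n ∈ N.jumpIndices ω, f (N.jumpTime ω n, N.X (n + 1) ω) := by
  rw [jumpMeasure_eq, lintegral_finsetSum_measure]
  simp

lemma setIntegral_jumpMeasure (ω : Ω) (f : ℝ≥0 × K → ℝ) (a b : ℝ≥0) :
    ∫ q in Ioc a b ×ˢ univ, f q ∂(N.jumpMeasure ω)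
      = ∑ n ∈ N.jumpIndices ω with N.jumpTime ω n ∈ Ioc a b,
          f (N.jumpTime ω n, N.X (n + 1) ω) := by
  classical
  rw [← integral_indicator (measurableSet_Ioc.prod MeasurableSet.univ), jumpMeasure_eq,
    integral_finsetSum_measure (fun i _ => by
      refine integrable_dirac ?_
      simp), Finset.sum_filter]
  refine Finset.sum_congr rfl fun n _ => ?_
  rw [integral_dirac]
  simp [indicator]

end JumpMeasure

end MarkedPointProcess

/-! ### Integration against the compensator. -/

namespace MarkedPointProcess

variable {Ω : Type*} [mΩ : MeasurableSpace Ω] {P : Measure Ω}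
  {K : Type*} [mK : MeasurableSpace K] {T : ℝ≥0}

namespace Compensator

variable {N : MarkedPointProcess P K T} (c : N.Compensator)

/-- The transition probability `φ`, as a kernel for the product σ-field. -/
def markKernel : Kernel (Ω × ℝ≥0) K :=
  Kernel.comap (mα := N.predictableSigma) c.φ Prod.swap N.measurable_swap_predictable

instance : IsMarkovKernel c.markKernel := ⟨fun _ => c.prob_φ _⟩

instance : IsSFiniteKernel c.dA := c.sFinite_dA

instance (q : ℝ≥0 × Ω) : IsProbabilityMeasure (c.φ q) := c.prob_φ q

lemma ν_eq : c.ν = c.dA.compProd c.markKernel := rfl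

instance : IsSFiniteKernel c.ν := by rw [ν_eq]; infer_instance

lemma measurable_shuffle : Measurable[mΩ.prod (inferInstance : MeasurableSpace (ℝ≥0 × K)),
    N.predictableSigma.prod mK] fun r : Ω × (ℝ≥0 × K) => ((r.2.1, r.1), r.2.2) := by
  have h : Measurable fun r : Ω × (ℝ≥0 × K) => (r.1, r.2.1) := by fun_prop
  exact Measurable.prodMk (N.measurable_swap_predictable.comp h)
    (measurable_snd.comp measurable_snd)

variable {H : (ℝ≥0 × Ω) × K → ℝ≥0∞}

lemma measurable_uncurry {G : Type*} [MeasurableSpace G] {H : (ℝ≥0 × Ω) × K → G}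
    (hH : Measurable[N.predictableSigma.prod mK] H) :
    Measurable fun r : Ω × (ℝ≥0 × K) => H ((r.2.1, r.1), r.2.2) :=
  hH.comp measurable_shuffle

lemma measurable_section {G : Type*} [MeasurableSpace G] {H : (ℝ≥0 × Ω) × K → G}
    (hH : Measurable[N.predictableSigma.prod mK] H) (ω : Ω) :
    Measurable fun q : ℝ≥0 × K => H ((q.1, ω), q.2) :=
  (measurable_uncurry hH).comp measurable_prodMk_left

lemma measurable_lintegral_ν (hH : Measurable[N.predictableSigma.prod mK] H) :
    Measurable fun ω => ∫⁻ q, H ((q.1, ω), q.2) ∂(c.ν ω) :=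
  (measurable_uncurry hH).lintegral_kernel_prod_right'

lemma lintegral_ν (hH : Measurable[N.predictableSigma.prod mK] H) (ω : Ω) :
    ∫⁻ q, H ((q.1, ω), q.2) ∂(c.ν ω)
      = ∫⁻ s, ∫⁻ x, H ((s, ω), x) ∂(c.φ (s, ω)) ∂(c.dA ω) := by
  rw [ν_eq, Kernel.lintegral_compProd _ _ _ (measurable_section hH ω)]
  rfl

lemma lintegral_ν_time {h : ℝ≥0 × Ω → ℝ≥0∞} (hh : Measurable[N.predictableSigma] h) (ω : Ω) :
    ∫⁻ q, h (q.1, ω) ∂(c.ν ω) = ∫⁻ s, h (s, ω) ∂(c.dA ω) := by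
  rw [c.lintegral_ν (H := fun q => h q.1) (hh.comp measurable_fst)]
  simp

/-- `E ∫ H dν`. -/
def expect (H : (ℝ≥0 × Ω) × K → ℝ≥0∞) : ℝ≥0∞ := ∫⁻ ω, ∫⁻ q, H ((q.1, ω), q.2) ∂(c.ν ω) ∂P

lemma lintegral_jumpMeasure_eq_expect (hH : Measurable[N.predictableSigma.prod mK] H) :
    ∫⁻ ω, ∫⁻ q, H ((q.1, ω), q.2) ∂(N.jumpMeasure ω) ∂P = c.expect H := c.compensates H hH

lemma expect_mono {H₁ H₂ : (ℝ≥0 × Ω) × K → ℝ≥0∞} (h : ∀ q, H₁ q ≤ H₂ q) :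
    c.expect H₁ ≤ c.expect H₂ := lintegral_mono fun _ => lintegral_mono fun _ => h _

lemma expect_add {H₁ : (ℝ≥0 × Ω) × K → ℝ≥0∞} (h₁ : Measurable[N.predictableSigma.prod mK] H₁)
    (H₂ : (ℝ≥0 × Ω) × K → ℝ≥0∞) :
    c.expect (fun q => H₁ q + H₂ q) = c.expect H₁ + c.expect H₂ := by
  simp_rw [expect]
  rw [← lintegral_add_left (c.measurable_lintegral_ν h₁)]
  refine lintegral_congr fun ω => ?_
  rw [lintegral_add_left (measurable_section h₁ ω)]

lemma expect_const_mul {r : ℝ≥0∞} (hr : r ≠ ∞) (H : (ℝ≥0 × Ω) × K → ℝ≥0∞) :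
    c.expect (fun q => r * H q) = r * c.expect H := by
  simp_rw [expect, lintegral_const_mul' _ _ hr]

/-- The mass of `{t}` is at most `A_t - A_s` for every `s < t`, which tends to 0. There is no such
`s` for `t = 0`, where `zero_dA` takes over. -/
lemma nullSingletonClass_dA (hc : c.ContinuousA) :
    ∀ᵐ ω ∂P, NullSingletonClass (c.dA ω) := by
  filter_upwards [hc, c.finite_dA, c.zero_dA] with ω hω hfin h0
  have : IsFiniteMeasure (c.dA ω) := ⟨hfin⟩
  refine ⟨fun t => ?_⟩
  rcases eq_or_ne t 0 with rfl | ht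
  · exact h0
  have hlim : Tendsto (fun s => c.A t ω - c.A s ω) (𝓝[<] t) (𝓝 0) := by
    have := (hω.tendsto t).mono_left (nhdsWithin_le_nhds (s := Iio t))
    simpa using this.const_sub (c.A t ω)
  have hle : (c.dA ω).real {t} ≤ 0 := by
    have : (𝓝[<] t).NeBot := nhdsLT_neBot_of_exists_lt ⟨0, pos_iff_ne_zero.2 ht⟩
    refine ge_of_tendsto hlim ?_
    filter_upwards [self_mem_nhdsWithin] with s (hs : s < t)
    have hsub : Iic s ⊆ Iic t := Iic_subset_Iic.2 hs.le
    have := measureReal_sdiff (μ := c.dA ω) hsub measurableSet_Iic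
    change _ ≤ (c.dA ω).real (Iic t) - (c.dA ω).real (Iic s)
    rw [← this]
    refine measureReal_mono ?_
    rintro r rfl
    simp [hs]
  rw [← measureReal_eq_zero_iff]
  exact le_antisymm hle measureReal_nonneg

lemma A_eq_add {ω : Ω} (hfin : c.dA ω univ < ∞) {a t : ℝ≥0} (hat : a ≤ t) :
    c.A t ω = c.A a ω + (c.dA ω).real (Ioc a t) := by
  have : IsFiniteMeasure (c.dA ω) := ⟨hfin⟩
  change (c.dA ω).real (Iic t) = (c.dA ω).real (Iic a) + _
  rw [← Iic_union_Ioc_eq_Iic hat, measureReal_union _ measurableSet_Ioc]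
  rw [Set.disjoint_left]
  intro x hx hx'
  exact absurd hx'.1 (not_lt.2 hx)

lemma measurable_weight (β : ℝ) :
    Measurable[N.predictableSigma] fun q : ℝ≥0 × Ω => c.weight β q.1 q.2 :=
  ENNReal.measurable_ofReal.comp (Real.measurable_exp.comp (c.predictable_A.const_mul β))

/-- The weight `e^{β A}` on the stochastic interval `(S k, T]`. -/
def weightAfter (β : ℝ) (k : ℕ) : ℝ≥0 × Ω → ℝ≥0∞ :=
  (N.afterJump k).indicator fun q => c.weight β q.1 q.2

lemma measurable_weightAfter (β : ℝ) (k : ℕ) :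
    Measurable[N.predictableSigma] (c.weightAfter β k) :=
  (c.measurable_weight β).indicator (N.measurableSet_afterJump k)

lemma weight_ne_zero (β : ℝ) (t : ℝ≥0) (ω : Ω) : c.weight β t ω ≠ 0 := by
  simp [weight, Real.exp_pos]

variable [MeasurableSingletonClass K]

/-- The jump times have no mass at the horizon. -/
lemma ae_S_ne_horizon (hc : c.ContinuousA) {m : ℕ} (hm : 1 ≤ m) : ∀ᵐ ω ∂P, N.S m ω ≠ T := by
  set H : (ℝ≥0 × Ω) × K → ℝ≥0∞ := fun q => ({T} : Set ℝ≥0).indicator 1 q.1.1 with hH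
  have hHm : Measurable[N.predictableSigma.prod mK] H :=
    (measurable_one.indicator (measurableSet_singleton T)).comp
      (N.measurable_time.comp measurable_fst)
  -- The set `{T} × K` is deterministic, hence predictable, and `ν`-null; its expected `μ`-mass
  -- dominates `P(S m = T)`.
  have hz : c.expect H = 0 := by
    rw [expect, lintegral_eq_zero_iff (c.measurable_lintegral_ν hHm)]
    filter_upwards [c.nullSingletonClass_dA hc] with ω hω
    rw [c.lintegral_ν hHm]
    simp only [hH, lintegral_const, measure_univ, mul_one]
    rw [lintegral_indicator_one (measurableSet_singleton T)]
    exact measure_singleton T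
  have hsub : P (N.S m ⁻¹' {(T : ℝ≥0∞)}) ≤ 0 := by
    rw [← hz, ← c.lintegral_jumpMeasure_eq_expect hHm,
      ← lintegral_indicator_one (N.measurable_S m (measurableSet_singleton _))]
    refine lintegral_mono fun ω => ?_
    rw [N.lintegral_jumpMeasure]
    by_cases hω : N.S m ω = T
    · obtain ⟨n, rfl⟩ : ∃ n, m = n + 1 := ⟨m - 1, by omega⟩
      have hn : n ∈ N.jumpIndices ω := N.mem_jumpIndices.2 hω.le
      refine le_trans ?_ (Finset.single_le_sum (fun _ _ => zero_le) hn)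
      have : N.jumpTime ω n = T := by simp [jumpTime, hω]
      simp [hH, this, indicator, hω]
    · rw [indicator_of_notMem]
      · exact zero_le
      · exact hω
  rw [ae_iff]
  refine le_antisymm ((measure_mono fun ω hω => ?_).trans hsub) zero_le
  simpa using hω

end Compensator

end MarkedPointProcess

/-! ### Paths of solutions: increments, left limits and energy. -/

namespace MarkedPointProcess

variable {Ω : Type*} [mΩ : MeasurableSpace Ω] {P : Measure Ω}
  {K : Type*} [mK : MeasurableSpace K] {T : ℝ≥0}

namespace Compensator

variable {N : MarkedPointProcess P K T} (c : N.Compensator)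

/-- The driver averaged over the marks. -/
def meanDriver (g : Ω → ℝ≥0 × K → ℝ) (ω : Ω) (s : ℝ≥0) : ℝ := ∫ x, g ω (s, x) ∂(c.φ (s, ω))

lemma integrable_meanDriver {g : Ω → ℝ≥0 × K → ℝ} {ω : Ω}
    (hg : IntegrableOn (g ω) (Ioc 0 T ×ˢ univ) (c.ν ω)) :
    IntegrableOn (c.meanDriver g ω) (Ioc 0 T) (c.dA ω) := by
  have h : Integrable (g ω) ((c.dA.restrict (measurableSet_Ioc (a := 0) (b := T))
      ⊗ₖ c.markKernel.restrict MeasurableSet.univ) ω) := by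
    rw [Kernel.compProd_restrict, Kernel.restrict_apply, ← ν_eq]
    exact hg
  have h' := h.integral_compProd
  simp only [Kernel.restrict_apply, Measure.restrict_univ] at h'
  exact h'

lemma setIntegral_ν {g : Ω → ℝ≥0 × K → ℝ} {ω : Ω}
    (hg : IntegrableOn (g ω) (Ioc 0 T ×ˢ univ) (c.ν ω)) (t : ℝ≥0) :
    ∫ q in Ioc t T ×ˢ univ, g ω q ∂(c.ν ω) = ∫ s in Ioc t T, c.meanDriver g ω s ∂(c.dA ω) := by
  rw [ν_eq, setIntegral_compProd_univ_right _ measurableSet_Ioc]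
  · rfl
  · exact hg.mono_set (prod_mono_left (Ioc_subset_Ioc_left zero_le))

/-- A solution of the backward equation with a prescribed driver `g`. -/
structure IsLinearSolution (ξ : Ω → ℝ) (g : Ω → ℝ≥0 × K → ℝ) (Y : ℝ≥0 → Ω → ℝ)
    (Z : ℝ≥0 → Ω → K → ℝ) : Prop where
  adapted : ∀ t ≤ T, Measurable[N.filtration t] (Y t)
  left_limits : ∀ ω, ∀ t ≤ T, ∃ l, Tendsto (fun s => Y s ω) (𝓝[<] t) (𝓝 l)
  predictable : N.IsPredictable Z
  integrable : ∀ᵐ ω ∂P, IntegrableOn (g ω) (Ioc 0 T ×ˢ univ) (c.ν ω)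
  equation : ∀ᵐ ω ∂P, ∀ t ≤ T, Y t ω + ∫ q in Ioc t T ×ˢ univ, Z q.1 ω q.2 ∂(N.jumpMeasure ω)
    = ξ ω + ∫ q in Ioc t T ×ˢ univ, g ω q ∂(c.ν ω)

section Path

variable [MeasurableSingletonClass K] {ω : Ω} {ξ : Ω → ℝ} {g : Ω → ℝ≥0 × K → ℝ}
  {Y : ℝ≥0 → Ω → ℝ} {Z : ℝ≥0 → Ω → K → ℝ}

/-- Subtracting the backward equations at `a` and `t` gives a forward equation. It is stated for
`dA` restricted to `(0, T]`, where the driver is integrable, and with the jumps after `a` filtered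
first, to match `energy_inequality`. -/
lemma path_increment (hg : IntegrableOn (g ω) (Ioc 0 T ×ˢ univ) (c.ν ω))
    (heq : ∀ t ≤ T, Y t ω + ∫ q in Ioc t T ×ˢ univ, Z q.1 ω q.2 ∂(N.jumpMeasure ω)
      = ξ ω + ∫ q in Ioc t T ×ˢ univ, g ω q ∂(c.ν ω)) {a t : ℝ≥0} (hat : a ≤ t) (htT : t ≤ T) :
    Y t ω = Y a ω - ∫ s in Ioc a t, c.meanDriver g ω s ∂((c.dA ω).restrict (Ioc 0 T))
      + ∑ n ∈ (N.jumpIndices ω).filter (fun n => a < N.jumpTime ω n) with N.jumpTime ω n ≤ t,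
          Z (N.jumpTime ω n) ω (N.X (n + 1) ω) := by
  classical
  have h1 := heq t htT
  have h2 := heq a (hat.trans htT)
  rw [N.setIntegral_jumpMeasure, c.setIntegral_ν hg] at h1 h2
  have hG := c.integrable_meanDriver hg
  have hres : ((c.dA ω).restrict (Ioc 0 T)).restrict (Ioc a t) = (c.dA ω).restrict (Ioc a t) := by
    rw [Measure.restrict_restrict measurableSet_Ioc, inter_eq_left.2]
    exact Ioc_subset_Ioc zero_le htT
  have hint : ∫ s in Ioc a T, c.meanDriver g ω s ∂(c.dA ω)
      = ∫ s in Ioc a t, c.meanDriver g ω s ∂(c.dA ω)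
        + ∫ s in Ioc t T, c.meanDriver g ω s ∂(c.dA ω) := by
    rw [← Ioc_union_Ioc_eq_Ioc hat htT, setIntegral_union (Ioc_disjoint_Ioc_of_le le_rfl)
      measurableSet_Ioc]
    · exact hG.mono_set (Ioc_subset_Ioc zero_le htT)
    · exact hG.mono_set (Ioc_subset_Ioc zero_le le_rfl)
  have hsum : ∑ n ∈ N.jumpIndices ω with N.jumpTime ω n ∈ Ioc a T,
        Z (N.jumpTime ω n) ω (N.X (n + 1) ω)
      = ∑ n ∈ (N.jumpIndices ω).filter (fun n => a < N.jumpTime ω n) with N.jumpTime ω n ≤ t,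
          Z (N.jumpTime ω n) ω (N.X (n + 1) ω)
        + ∑ n ∈ N.jumpIndices ω with N.jumpTime ω n ∈ Ioc t T,
          Z (N.jumpTime ω n) ω (N.X (n + 1) ω) := by
    rw [Finset.filter_filter, ← Finset.sum_union]
    · refine Finset.sum_congr ?_ fun _ _ => rfl
      ext n
      simp only [Finset.mem_filter, Finset.mem_union, mem_Ioc]
      constructor
      · rintro ⟨h, h1, h2⟩
        rcases le_or_gt (N.jumpTime ω n) t with h3 | h3
        · exact Or.inl ⟨h, h1, h3⟩
        · exact Or.inr ⟨h, h3, h2⟩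
      · rintro (⟨h, h1, h2⟩ | ⟨h, h1, h2⟩)
        · exact ⟨h, h1, h2.trans htT⟩
        · exact ⟨h, hat.trans_lt h1, h2⟩
    · rw [Finset.disjoint_filter]
      rintro n - ⟨-, h1⟩ ⟨h2, -⟩
      exact absurd h1 (not_le.2 h2)
  rw [hres]
  simp only at h1 h2
  linarith

/-- On `[0, T]` the path is a `jumpPath`, whose continuous part does not jump because `dA` has no
atoms. -/
lemma leftValue_eq [NullSingletonClass (c.dA ω)]
    (hg : IntegrableOn (g ω) (Ioc 0 T ×ˢ univ) (c.ν ω))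
    (heq : ∀ t ≤ T, Y t ω + ∫ q in Ioc t T ×ˢ univ, Z q.1 ω q.2 ∂(N.jumpMeasure ω)
      = ξ ω + ∫ q in Ioc t T ×ˢ univ, g ω q ∂(c.ν ω)) {s : ℝ≥0} (hs : s ∈ Ioc 0 T) :
    leftValue T Y (s, ω) = Y s ω - ∑ n ∈ N.jumpIndices ω with N.jumpTime ω n = s,
      Z (N.jumpTime ω n) ω (N.X (n + 1) ω) := by
  have hG : Integrable (fun r => - c.meanDriver g ω r) ((c.dA ω).restrict (Ioc 0 T)) :=
    (c.integrable_meanDriver hg).neg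
  have hfil : (N.jumpIndices ω).filter (fun n => 0 < N.jumpTime ω n) = N.jumpIndices ω :=
    Finset.filter_true_of_mem fun n hn => (N.jumpTime_mem hn).1
  have hYu : ∀ t ≤ T, Y t ω = jumpPath ((c.dA ω).restrict (Ioc 0 T)) 0 (Y 0 ω)
      (fun r => - c.meanDriver g ω r) (N.jumpIndices ω) (N.jumpTime ω)
      (fun n => Z (N.jumpTime ω n) ω (N.X (n + 1) ω)) t := by
    intro t ht
    rw [c.path_increment hg heq (zero_le : 0 ≤ t) ht, hfil, jumpPath, integral_neg,
      sub_eq_add_neg]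
  have hlim := jumpPath_tendsto_left (a := 0) (u₀ := Y 0 ω) (I := N.jumpIndices ω)
    (τ := N.jumpTime ω) (j := fun n => Z (N.jumpTime ω n) ω (N.X (n + 1) ω)) hG s
  rw [← hYu s hs.2] at hlim
  have hne : (𝓝[<] s).NeBot := nhdsLT_neBot_of_exists_lt ⟨0, hs.1⟩
  simp only [leftValue, hs, if_true]
  refine leftLim_eq_of_tendsto (hlim.congr' ?_)
  filter_upwards [self_mem_nhdsWithin] with r (hr : r < s)
  exact (hYu r (hr.le.trans hs.2)).symm

/-- The two sides differ at jump times only, and a finite set is null for an atomless measure. -/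
lemma leftValue_ae_eq [NullSingletonClass (c.dA ω)]
    (hg : IntegrableOn (g ω) (Ioc 0 T ×ˢ univ) (c.ν ω))
    (heq : ∀ t ≤ T, Y t ω + ∫ q in Ioc t T ×ˢ univ, Z q.1 ω q.2 ∂(N.jumpMeasure ω)
      = ξ ω + ∫ q in Ioc t T ×ˢ univ, g ω q ∂(c.ν ω)) :
    ∀ᵐ s ∂(c.dA ω), s ∈ Ioc 0 T → leftValue T Y (s, ω) = Y s ω := by
  have h : ∀ᵐ s ∂(c.dA ω), s ∉ (N.jumpIndices ω).image (N.jumpTime ω) := by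
    have := ((N.jumpIndices ω).image (N.jumpTime ω)).finite_toSet.measure_zero (c.dA ω)
    rw [measure_eq_zero_iff_ae_notMem] at this
    simpa using this
  filter_upwards [h] with s hs hsT
  rw [c.leftValue_eq hg heq hsT, Finset.filter_false_of_mem]
  · simp
  · intro n hn h
    exact hs (Finset.mem_image.2 ⟨n, hn, h⟩)

lemma leftValue_jumpTime [NullSingletonClass (c.dA ω)]
    (hstrict : ∀ n, N.S n ω ≤ T → N.S n ω < N.S (n + 1) ω)
    (hg : IntegrableOn (g ω) (Ioc 0 T ×ˢ univ) (c.ν ω))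
    (heq : ∀ t ≤ T, Y t ω + ∫ q in Ioc t T ×ˢ univ, Z q.1 ω q.2 ∂(N.jumpMeasure ω)
      = ξ ω + ∫ q in Ioc t T ×ˢ univ, g ω q ∂(c.ν ω)) {n : ℕ} (hn : n ∈ N.jumpIndices ω) :
    leftValue T Y (N.jumpTime ω n, ω)
      = Y (N.jumpTime ω n) ω - Z (N.jumpTime ω n) ω (N.X (n + 1) ω) := by
  have : (N.jumpIndices ω).filter (fun k => N.jumpTime ω k = N.jumpTime ω n) = {n} := by
    ext k
    simp only [Finset.mem_filter, Finset.mem_singleton]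
    exact ⟨fun h => N.jumpTime_injOn hstrict h.1 hn h.2, fun h => by subst h; exact ⟨hn, rfl⟩⟩
  rw [c.leftValue_eq hg heq (N.jumpTime_mem hn), this]
  simp

/-- The pathwise energy inequality on `(S k, T]`. -/
lemma path_energy (hfin : c.dA ω univ < ∞) [NullSingletonClass (c.dA ω)]
    (hstrict : ∀ n, N.S n ω ≤ T → N.S n ω < N.S (n + 1) ω)
    (hg : IntegrableOn (g ω) (Ioc 0 T ×ˢ univ) (c.ν ω))
    (heq : ∀ t ≤ T, Y t ω + ∫ q in Ioc t T ×ˢ univ, Z q.1 ω q.2 ∂(N.jumpMeasure ω)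
      = ξ ω + ∫ q in Ioc t T ×ˢ univ, g ω q ∂(c.ν ω)) {p β : ℝ} (hp : 1 < p) (hβ : 0 ≤ β) (k : ℕ) :
    ENNReal.ofReal β
        * ∫⁻ s, c.weightAfter β k (s, ω) * ‖leftValue T Y (s, ω)‖ₑ ^ p ∂(c.dA ω)
      + ∫⁻ q, c.weightAfter β k (q.1, ω)
          * ‖leftValue T Y (q.1, ω) + if q.1 ≤ T then Z q.1 ω q.2 else 0‖ₑ ^ p ∂(N.jumpMeasure ω)
      ≤ {ω | N.S k ω ≤ T}.indicator (fun ω => c.weight β T ω * ‖ξ ω‖ₑ ^ p) ω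
        + ∫⁻ s, c.weightAfter β k (s, ω) * (ENNReal.ofReal p
            * ‖leftValue T Y (s, ω)‖ₑ ^ (p - 1) * ‖c.meanDriver g ω s‖ₑ) ∂(c.dA ω)
        + ∫⁻ q, c.weightAfter β k (q.1, ω) * ‖leftValue T Y (q.1, ω)‖ₑ ^ p
            ∂(N.jumpMeasure ω) := by
  classical
  have hfinm : IsFiniteMeasure (c.dA ω) := ⟨hfin⟩
  by_cases hS : N.S k ω ≤ T
  swap
  -- If `S k > T`, the interval `(S k, T]` is empty and the left side vanishes.
  · have hz : ∀ s, c.weightAfter β k (s, ω) = 0 := by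
      intro s
      refine indicator_of_notMem (fun h => hS ?_) _
      exact h.1.le.trans (by exact_mod_cast h.2)
    simp [hz]
  obtain ⟨a, ha⟩ : ∃ a : ℝ≥0, (a : ℝ≥0∞) = N.S k ω :=
    ⟨_, ENNReal.coe_toNNReal (ne_top_of_le_ne_top ENNReal.coe_ne_top hS)⟩
  have haT : a ≤ T := by rw [← ha] at hS; exact_mod_cast hS
  have hW : ∀ s, c.weightAfter β k (s, ω)
      = (Ioc a T).indicator (fun s => ENNReal.ofReal (Real.exp (β * c.A s ω))) s := by
    intro s
    simp only [weightAfter, indicator, afterJump, mem_ofPred_eq, ← ha, ENNReal.coe_lt_coe, mem_Ioc,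
      weight]
  have hG := c.integrable_meanDriver hg
  have hYT : Y T ω = ξ ω := by simpa using heq T le_rfl
  set I := (N.jumpIndices ω).filter (fun n => a < N.jumpTime ω n) with hI
  have hIsub : ∀ n ∈ I, n ∈ N.jumpIndices ω := fun n hn => (Finset.mem_filter.1 hn).1
  have hE := energy_inequality (m := (c.dA ω).restrict (Ioc 0 T)) haT hG
    (A := fun t => c.A t ω) (y := fun t => Y t ω)
    (fun t ht => by
      rw [c.A_eq_add hfin ht.1, measureReal_restrict_apply measurableSet_Ioc, inter_eq_left.2]
      exact Ioc_subset_Ioc zero_le ht.2)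
    (I := I) (τ := N.jumpTime ω) (z := fun n => Z (N.jumpTime ω n) ω (N.X (n + 1) ω))
    ((N.jumpTime_injOn hstrict).mono (by exact_mod_cast hIsub))
    (fun n hn => ⟨(Finset.mem_filter.1 hn).2, (N.jumpTime_mem (hIsub n hn)).2⟩)
    (fun t ht => c.path_increment hg heq ht.1 ht.2) hp hβ
  have hres : ((c.dA ω).restrict (Ioc 0 T)).restrict (Ioc a T) = (c.dA ω).restrict (Ioc a T) := by
    rw [Measure.restrict_restrict measurableSet_Ioc, inter_eq_left.2]
    exact Ioc_subset_Ioc zero_le le_rfl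
  have hae := c.leftValue_ae_eq hg heq
  have hmem : ∀ s, s ∈ Ioc a T → s ∈ Ioc 0 T := fun s hs => ⟨lt_of_le_of_lt zero_le hs.1, hs.2⟩
  have e1 : ∫⁻ s, c.weightAfter β k (s, ω) * ‖leftValue T Y (s, ω)‖ₑ ^ p ∂(c.dA ω)
      = ∫⁻ s in Ioc a T, ENNReal.ofReal (Real.exp (β * c.A s ω)) * ‖Y s ω‖ₑ ^ p ∂(c.dA ω) := by
    rw [← lintegral_indicator measurableSet_Ioc]
    refine lintegral_congr_ae ?_
    filter_upwards [hae] with s hs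
    rw [hW]
    by_cases h : s ∈ Ioc a T
    · simp [h, hs (hmem s h)]
    · simp [h]
  have e2 : ∫⁻ s, c.weightAfter β k (s, ω) * (ENNReal.ofReal p
            * ‖leftValue T Y (s, ω)‖ₑ ^ (p - 1) * ‖c.meanDriver g ω s‖ₑ) ∂(c.dA ω)
      = ∫⁻ s in Ioc a T, ENNReal.ofReal (Real.exp (β * c.A s ω)) * (ENNReal.ofReal p
          * ‖Y s ω‖ₑ ^ (p - 1) * ‖c.meanDriver g ω s‖ₑ) ∂(c.dA ω) := by
    rw [← lintegral_indicator measurableSet_Ioc]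
    refine lintegral_congr_ae ?_
    filter_upwards [hae] with s hs
    rw [hW]
    by_cases h : s ∈ Ioc a T
    · simp [h, hs (hmem s h)]
    · simp [h]
  have hjump : ∀ n ∈ N.jumpIndices ω, (N.jumpTime ω n ∈ Ioc a T ↔ a < N.jumpTime ω n) :=
    fun n hn => ⟨fun h => h.1, fun h => ⟨h, (N.jumpTime_mem hn).2⟩⟩
  -- At a jump time `Y = Y_- + Z` and `Y - Z = Y_-`. Rewritten this way, both jump sums are
  -- `μ`-integrals of predictable integrands, ready for compensation.
  have e3 : ∫⁻ q, c.weightAfter β k (q.1, ω)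
      * ‖leftValue T Y (q.1, ω) + if q.1 ≤ T then Z q.1 ω q.2 else 0‖ₑ ^ p ∂(N.jumpMeasure ω)
      = ∑ n ∈ I, ENNReal.ofReal (Real.exp (β * c.A (N.jumpTime ω n) ω))
          * ‖Y (N.jumpTime ω n) ω‖ₑ ^ p := by
    rw [N.lintegral_jumpMeasure, hI, Finset.sum_filter]
    refine Finset.sum_congr rfl fun n hn => ?_
    simp only [hW, indicator, hjump n hn, c.leftValue_jumpTime hstrict hg heq hn,
      (N.jumpTime_mem hn).2, if_true, sub_add_cancel]
    split_ifs <;> simp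
  have e4 : ∫⁻ q, c.weightAfter β k (q.1, ω) * ‖leftValue T Y (q.1, ω)‖ₑ ^ p
        ∂(N.jumpMeasure ω)
      = ∑ n ∈ I, ENNReal.ofReal (Real.exp (β * c.A (N.jumpTime ω n) ω))
          * ‖Y (N.jumpTime ω n) ω - Z (N.jumpTime ω n) ω (N.X (n + 1) ω)‖ₑ ^ p := by
    rw [N.lintegral_jumpMeasure, hI, Finset.sum_filter]
    refine Finset.sum_congr rfl fun n hn => ?_
    simp only [hW, indicator, hjump n hn, c.leftValue_jumpTime hstrict hg heq hn]
    split_ifs <;> simp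
  have e5 : {ω | N.S k ω ≤ T}.indicator (fun ω => c.weight β T ω * ‖ξ ω‖ₑ ^ p) ω
      = ENNReal.ofReal (Real.exp (β * c.A T ω)) * ‖Y T ω‖ₑ ^ p := by
    rw [indicator_of_mem (by exact hS), hYT]; rfl
  rw [hres] at hE
  rw [e1, e2, e3, e4, e5]
  exact hE

end Path

end Compensator

end MarkedPointProcess

/-! ### The a priori estimate in expectation. -/

namespace MarkedPointProcess

variable {Ω : Type*} [mΩ : MeasurableSpace Ω] {P : Measure Ω}
  {K : Type*} [mK : MeasurableSpace K] {T : ℝ≥0}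

/-- The values of a process up to the horizon. -/
def cutValue (T : ℝ≥0) (Z : ℝ≥0 → Ω → K → ℝ) (q : (ℝ≥0 × Ω) × K) : ℝ :=
  if q.1.1 ≤ T then Z q.1.1 q.1.2 q.2 else 0

namespace Compensator

variable {N : MarkedPointProcess P K T} (c : N.Compensator)

/-- `E ∫ |Y_-|^p e^{βA} dν` over the stochastic interval `(S k, T]`. -/
def energyY (p β : ℝ) (k : ℕ) (Y : ℝ≥0 → Ω → ℝ) : ℝ≥0∞ :=
  c.expect fun q => c.weightAfter β k q.1 * ‖leftValue T Y q.1‖ₑ ^ p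

/-- `E ∫ |Z|^p e^{βA} dν` over the stochastic interval `(S k, T]`. -/
def energyZ (p β : ℝ) (k : ℕ) (Z : ℝ≥0 → Ω → K → ℝ) : ℝ≥0∞ :=
  c.expect fun q => c.weightAfter β k q.1 * ‖cutValue T Z q‖ₑ ^ p

lemma weightAfter_le (β : ℝ) (k : ℕ) (q : ℝ≥0 × Ω) :
    c.weightAfter β k q ≤ c.weightAfter β 0 q := by
  refine indicator_le_indicator_of_subset (fun q hq => ?_) (fun _ => zero_le) q
  exact ⟨((N.S_monotone q.2) (Nat.zero_le k)).trans_lt hq.1, hq.2⟩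

lemma measurable_weight_time (β : ℝ) (t : ℝ≥0) : Measurable (c.weight β t) :=
  ENNReal.measurable_ofReal.comp (Real.measurable_exp.comp
    ((c.dA.measurable_coe measurableSet_Iic).ennreal_toReal.const_mul β))

lemma energyY_le (p β : ℝ) (k : ℕ) (Y : ℝ≥0 → Ω → ℝ) : c.energyY p β k Y ≤ c.energyY p β 0 Y :=
  c.expect_mono fun q => mul_le_mul_left (c.weightAfter_le β k q.1) _

lemma energyZ_le (p β : ℝ) (k : ℕ) (Z : ℝ≥0 → Ω → K → ℝ) :
    c.energyZ p β k Z ≤ c.energyZ p β 0 Z :=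
  c.expect_mono fun q => mul_le_mul_left (c.weightAfter_le β k q.1) _

lemma measurable_weightAfter_mul (β : ℝ) (k : ℕ) {H : (ℝ≥0 × Ω) × K → ℝ≥0∞}
    (hH : Measurable[N.predictableSigma.prod mK] H) :
    Measurable[N.predictableSigma.prod mK] fun q => c.weightAfter β k q.1 * H q :=
  ((c.measurable_weightAfter β k).comp measurable_fst).mul hH

lemma measurable_enorm_leftValue (p : ℝ) {Y : ℝ≥0 → Ω → ℝ}
    (hY : Measurable[N.predictableSigma] (leftValue T Y)) :
    Measurable[N.predictableSigma.prod mK]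
      fun q : (ℝ≥0 × Ω) × K => ‖leftValue T Y q.1‖ₑ ^ p :=
  ((measurable_enorm.comp hY).pow_const p).comp measurable_fst

lemma measurable_enorm_cutValue (p : ℝ) {Z : ℝ≥0 → Ω → K → ℝ} (hZ : N.IsPredictable Z) :
    Measurable[N.predictableSigma.prod mK] fun q => ‖cutValue T Z q‖ₑ ^ p :=
  (measurable_enorm.comp hZ).pow_const p

/-- This is `driver_bound` at each time, with `ν = dA φ` turning the averages over `φ` into
`ν`-integrals. Only averages over the marks can be used, because that is all the Lipschitz condition
in `ζ` controls. -/
lemma lintegral_driver_le {p β : ℝ} {L L' : ℝ≥0} (hp : 1 < p) {R₀ R₁ : ℝ} (hR₀ : 0 < R₀)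
    (hR₁ : 0 < R₁) {g : Ω → ℝ≥0 × K → ℝ} {Y : ℝ≥0 → Ω → ℝ} {Z : ℝ≥0 → Ω → K → ℝ}
    (hYm : Measurable[N.predictableSigma] (leftValue T Y)) (hZ : N.IsPredictable Z)
    {h : (ℝ≥0 × Ω) × K → ℝ≥0∞} (hh : Measurable[N.predictableSigma.prod mK] h) (k : ℕ)
    (hbound : ∀ᵐ ω ∂P, ∀ᵐ s ∂(c.dA ω), (s, ω) ∈ N.afterJump k →
      ∫⁻ x, ‖g ω (s, x)‖ₑ ∂(c.φ (s, ω)) ≤ L' * ‖leftValue T Y (s, ω)‖ₑ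
        + L * (∫⁻ x, ‖Z s ω x‖ₑ ^ p ∂(c.φ (s, ω))) ^ (1 / p)
        + ∫⁻ x, h ((s, ω), x) ∂(c.φ (s, ω))) :
    ∀ᵐ ω ∂P, ∫⁻ s, c.weightAfter β k (s, ω) * (ENNReal.ofReal p
        * ‖leftValue T Y (s, ω)‖ₑ ^ (p - 1) * ‖c.meanDriver g ω s‖ₑ) ∂(c.dA ω)
      ≤ ∫⁻ q, ((ENNReal.ofReal (p * L') + ENNReal.ofReal ((p - 1) * R₀ ^ (1 / (p - 1)))
            + ENNReal.ofReal ((p - 1) * R₁ ^ (1 / (p - 1))))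
              * (c.weightAfter β k (q.1, ω) * ‖leftValue T Y (q.1, ω)‖ₑ ^ p)
          + ENNReal.ofReal (L ^ p / R₀)
              * (c.weightAfter β k (q.1, ω) * ‖cutValue T Z ((q.1, ω), q.2)‖ₑ ^ p)
          + ENNReal.ofReal (1 / R₁)
              * (c.weightAfter β k (q.1, ω) * h ((q.1, ω), q.2) ^ p)) ∂(c.ν ω) := by
  have mY := c.measurable_weightAfter_mul β k (measurable_enorm_leftValue (mK := mK) p hYm)
  have mZ := c.measurable_weightAfter_mul β k (measurable_enorm_cutValue p hZ)
  have mH := c.measurable_weightAfter_mul β k (hh.pow_const p)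
  set κ : ℝ≥0∞ := ENNReal.ofReal (p * L') + ENNReal.ofReal ((p - 1) * R₀ ^ (1 / (p - 1)))
          + ENNReal.ofReal ((p - 1) * R₁ ^ (1 / (p - 1))) with hκ
  have mD : Measurable[N.predictableSigma.prod mK] fun q : (ℝ≥0 × Ω) × K =>
      κ * (c.weightAfter β k q.1 * ‖leftValue T Y q.1‖ₑ ^ p)
        + ENNReal.ofReal (L ^ p / R₀) * (c.weightAfter β k q.1 * ‖cutValue T Z q‖ₑ ^ p)
        + ENNReal.ofReal (1 / R₁) * (c.weightAfter β k q.1 * h q ^ p) :=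
    ((mY.const_mul _).add (mZ.const_mul _)).add (mH.const_mul _)
  filter_upwards [hbound] with ω hω
  rw [c.lintegral_ν mD]
  refine lintegral_mono_ae ?_
  filter_upwards [hω] with s hs
  by_cases hmem : (s, ω) ∈ N.afterJump k
  swap
  · have : c.weightAfter β k (s, ω) = 0 := indicator_of_notMem hmem _
    simp [this]
  have hsT : s ≤ T := hmem.2
  have hG : ‖c.meanDriver g ω s‖ₑ ≤ L' * ‖leftValue T Y (s, ω)‖ₑ
      + L * (∫⁻ x, ‖cutValue T Z ((s, ω), x)‖ₑ ^ p ∂(c.φ (s, ω))) ^ (1 / p)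
      + ∫⁻ x, h ((s, ω), x) ∂(c.φ (s, ω)) := by
    refine (enorm_integral_le_lintegral_enorm _).trans ?_
    simpa [cutValue, hsT] using hs hmem
  have hb := driver_bound (c.φ (s, ω)) hp hR₀ hR₁ L L' enorm_ne_top hG
  refine (mul_le_mul_right hb (c.weightAfter β k (s, ω))).trans_eq ?_
  have hW : c.weightAfter β k (s, ω) ≠ ∞ := by
    rw [weightAfter, indicator_of_mem hmem]; exact ENNReal.ofReal_ne_top
  have mZs : Measurable fun x => ‖cutValue T Z ((s, ω), x)‖ₑ ^ p :=
    (measurable_section (measurable_enorm_cutValue p hZ) ω).comp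
      measurable_prodMk_left
  rw [lintegral_add_left, lintegral_add_left measurable_const]
  · rw [lintegral_const, measure_univ, mul_one, lintegral_const_mul' _ _ ENNReal.ofReal_ne_top,
      lintegral_const_mul' _ _ ENNReal.ofReal_ne_top, lintegral_const_mul' _ _ hW,
      lintegral_const_mul' _ _ hW]
    ring
  · exact measurable_const.add ((mZs.const_mul _).const_mul _)

/-- The a priori estimate on `(S k, T]`. -/
theorem apriori_estimate [MeasurableSingletonClass K] (hc : c.ContinuousA)
    {p ε β : ℝ} {L L' : ℝ≥0} (hp : 1 < p) (hε : 0 < ε) (hβ : 0 ≤ β) {R₀ R₁ : ℝ} {C : ℝ≥0}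
    (hC : IsAprioriConstant p ε β L L' R₀ R₁ C)
    {ξ : Ω → ℝ} (hξ : Measurable ξ) {g : Ω → ℝ≥0 × K → ℝ} {Y : ℝ≥0 → Ω → ℝ}
    {Z : ℝ≥0 → Ω → K → ℝ} (hsol : c.IsLinearSolution ξ g Y Z)
    {h : (ℝ≥0 × Ω) × K → ℝ≥0∞} (hh : Measurable[N.predictableSigma.prod mK] h) (k : ℕ)
    (hbound : ∀ᵐ ω ∂P, ∀ᵐ s ∂(c.dA ω), (s, ω) ∈ N.afterJump k →
      ∫⁻ x, ‖g ω (s, x)‖ₑ ∂(c.φ (s, ω)) ≤ L' * ‖leftValue T Y (s, ω)‖ₑ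
        + L * (∫⁻ x, ‖Z s ω x‖ₑ ^ p ∂(c.φ (s, ω))) ^ (1 / p)
        + ∫⁻ x, h ((s, ω), x) ∂(c.φ (s, ω)))
    (hYfin : c.energyY p β k Y ≠ ∞) (hZfin : c.energyZ p β k Z ≠ ∞) :
    c.energyY p β k Y + c.energyZ p β k Z
      ≤ C * (∫⁻ ω, {ω | N.S k ω ≤ T}.indicator (fun ω => c.weight β T ω * ‖ξ ω‖ₑ ^ p) ω ∂P
          + c.expect fun q => c.weightAfter β k q.1 * h q ^ p) := by
  have hYm := N.measurable_leftValue hsol.adapted hsol.left_limits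
  have hZm : Measurable[N.predictableSigma.prod mK] (cutValue T Z) := hsol.predictable
  have mY := c.measurable_weightAfter_mul β k (measurable_enorm_leftValue (mK := mK) p hYm)
  have mZ := c.measurable_weightAfter_mul β k (measurable_enorm_cutValue p hsol.predictable)
  have mH := c.measurable_weightAfter_mul β k (hh.pow_const p)
  have mYZ : Measurable[N.predictableSigma.prod mK] fun q : (ℝ≥0 × Ω) × K =>
      c.weightAfter β k q.1 * ‖leftValue T Y q.1 + cutValue T Z q‖ₑ ^ p :=
    c.measurable_weightAfter_mul β k
      ((measurable_enorm.comp ((hYm.comp measurable_fst).add hZm)).pow_const p)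
  set κ : ℝ≥0∞ := ENNReal.ofReal (p * L') + ENNReal.ofReal ((p - 1) * R₀ ^ (1 / (p - 1)))
          + ENNReal.ofReal ((p - 1) * R₁ ^ (1 / (p - 1))) with hκ
  have hκtop : κ ≠ ∞ := by finiteness
  let D : (ℝ≥0 × Ω) × K → ℝ≥0∞ := fun q =>
    κ * (c.weightAfter β k q.1 * ‖leftValue T Y q.1‖ₑ ^ p)
      + ENNReal.ofReal (L ^ p / R₀) * (c.weightAfter β k q.1 * ‖cutValue T Z q‖ₑ ^ p)
      + ENNReal.ofReal (1 / R₁) * (c.weightAfter β k q.1 * h q ^ p)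
  have hD : D = fun q =>
    κ * (c.weightAfter β k q.1 * ‖leftValue T Y q.1‖ₑ ^ p)
      + ENNReal.ofReal (L ^ p / R₀) * (c.weightAfter β k q.1 * ‖cutValue T Z q‖ₑ ^ p)
      + ENNReal.ofReal (1 / R₁) * (c.weightAfter β k q.1 * h q ^ p) := rfl
  have mD : Measurable[N.predictableSigma.prod mK] D :=
    ((mY.const_mul _).add (mZ.const_mul _)).add (mH.const_mul _)
  have hDexp : c.expect D = κ * c.energyY p β k Y + ENNReal.ofReal (L ^ p / R₀) * c.energyZ p β k Z
      + ENNReal.ofReal (1 / R₁) * c.expect fun q => c.weightAfter β k q.1 * h q ^ p := by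
    have mYZ' : Measurable[N.predictableSigma.prod mK] fun q =>
        κ * (c.weightAfter β k q.1 * ‖leftValue T Y q.1‖ₑ ^ p)
          + ENNReal.ofReal (L ^ p / R₀) * (c.weightAfter β k q.1 * ‖cutValue T Z q‖ₑ ^ p) :=
      (mY.const_mul _).add (mZ.const_mul _)
    rw [hD, c.expect_add mYZ', c.expect_add (mY.const_mul _),
      c.expect_const_mul hκtop, c.expect_const_mul ENNReal.ofReal_ne_top,
      c.expect_const_mul ENNReal.ofReal_ne_top]
    rfl
  have mX : Measurable fun ω =>
      {ω | N.S k ω ≤ T}.indicator (fun ω => c.weight β T ω * ‖ξ ω‖ₑ ^ p) ω := by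
    refine Measurable.indicator ?_ (measurableSet_le (N.measurable_S k) measurable_const)
    refine Measurable.mul ?_ (hξ.enorm.pow_const p)
    exact c.measurable_weight_time β T
  have hdriver := c.lintegral_driver_le hp hC.pos₀ hC.pos₁ hYm hsol.predictable hh k hbound (β := β)
  have hpath : ∀ᵐ ω ∂P, ENNReal.ofReal β
        * ∫⁻ q, c.weightAfter β k (q.1, ω) * ‖leftValue T Y (q.1, ω)‖ₑ ^ p ∂(c.ν ω)
      + ∫⁻ q, c.weightAfter β k (q.1, ω)
          * ‖leftValue T Y (q.1, ω) + cutValue T Z ((q.1, ω), q.2)‖ₑ ^ p ∂(N.jumpMeasure ω)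
      ≤ {ω | N.S k ω ≤ T}.indicator (fun ω => c.weight β T ω * ‖ξ ω‖ₑ ^ p) ω
        + ∫⁻ q, D ((q.1, ω), q.2) ∂(c.ν ω)
        + ∫⁻ q, c.weightAfter β k (q.1, ω) * ‖leftValue T Y (q.1, ω)‖ₑ ^ p
            ∂(N.jumpMeasure ω) := by
    filter_upwards [hdriver, c.finite_dA, c.nullSingletonClass_dA hc, N.S_strict, hsol.integrable,
      hsol.equation] with ω hd hfin hnull hstrict hg heq
    rw [c.lintegral_ν_time (h := fun q => c.weightAfter β k q * ‖leftValue T Y q‖ₑ ^ p)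
      ((c.measurable_weightAfter β k).mul ((measurable_enorm.comp hYm).pow_const p))]
    refine (c.path_energy hfin hstrict hg heq hp hβ k).trans ?_
    gcongr
  have mXD : Measurable fun ω =>
      {ω | N.S k ω ≤ T}.indicator (fun ω => c.weight β T ω * ‖ξ ω‖ₑ ^ p) ω
        + ∫⁻ q, D ((q.1, ω), q.2) ∂(c.ν ω) := mX.add (c.measurable_lintegral_ν mD)
  have hint := lintegral_mono_ae hpath
  rw [lintegral_add_left ((c.measurable_lintegral_ν mY).const_mul _),
    lintegral_const_mul' _ _ ENNReal.ofReal_ne_top,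
    lintegral_add_left mXD, lintegral_add_left mX] at hint
  -- The passage from `μ` to `ν`. Nothing has been subtracted so far, so no integrability is needed.
  have j1 := c.lintegral_jumpMeasure_eq_expect mYZ
  have j2 := c.lintegral_jumpMeasure_eq_expect mY
  have hcond1 : ENNReal.ofReal β * c.energyY p β k Y
      + c.expect (fun q => c.weightAfter β k q.1
          * ‖leftValue T Y q.1 + cutValue T Z q‖ₑ ^ p)
      ≤ ∫⁻ ω, {ω | N.S k ω ≤ T}.indicator (fun ω => c.weight β T ω * ‖ξ ω‖ₑ ^ p) ω ∂P
        + c.expect D + c.energyY p β k Y := by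
    refine le_trans (le_of_eq ?_) (hint.trans_eq ?_)
    · exact congrArg (ENNReal.ofReal β * c.energyY p β k Y + ·) j1.symm
    · exact congrArg (_ + ·) j2
  rw [hDexp] at hcond1
  -- Absorption uses the finiteness of both energies. What remains is the integrated form of
  -- `enorm_rpow_le_cEps`.
  refine hC.absorb _ _ _ _ _ hYfin hZfin hcond1 ?_
  rw [energyY, ← c.expect_const_mul ENNReal.ofReal_ne_top,
    ← c.expect_const_mul ENNReal.ofReal_ne_top, ← c.expect_add (mYZ.const_mul _)]
  refine c.expect_mono fun q => ?_
  refine (mul_le_mul_right (enorm_rpow_le_cEps hp hε (leftValue T Y q.1) (cutValue T Z q))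
    (c.weightAfter β k q.1)).trans_eq ?_
  ring

end Compensator

end MarkedPointProcess

/-! ### Differences of solutions and finiteness of their energies. -/

namespace MarkedPointProcess

lemma leftValue_sub {Ω : Type*} {T : ℝ≥0} {Y Y' : ℝ≥0 → Ω → ℝ}
    (hY : ∀ ω, ∀ t ≤ T, ∃ l, Tendsto (fun s => Y s ω) (𝓝[<] t) (𝓝 l))
    (hY' : ∀ ω, ∀ t ≤ T, ∃ l, Tendsto (fun s => Y' s ω) (𝓝[<] t) (𝓝 l)) (q : ℝ≥0 × Ω) :
    leftValue T (fun s ω => Y s ω - Y' s ω) q = leftValue T Y q - leftValue T Y' q := by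
  by_cases hq : q.1 ∈ Ioc 0 T
  · simp only [leftValue, hq, if_true]
    have hne : (𝓝[<] q.1).NeBot := nhdsLT_neBot_of_exists_lt ⟨0, hq.1⟩
    exact leftLim_eq_of_tendsto ((tendsto_leftLim_of_tendsto (hY q.2 q.1 hq.2)).sub
      (tendsto_leftLim_of_tendsto (hY' q.2 q.1 hq.2)))
  · simp [leftValue, hq]

lemma cutValue_sub {Ω K : Type*} {T : ℝ≥0} (Z Z' : ℝ≥0 → Ω → K → ℝ) (q : (ℝ≥0 × Ω) × K) :
    cutValue T (fun s ω x => Z s ω x - Z' s ω x) q = cutValue T Z q - cutValue T Z' q := by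
  unfold cutValue
  split_ifs <;> simp

variable {Ω : Type*} [mΩ : MeasurableSpace Ω] {P : Measure Ω}
  {K : Type*} [mK : MeasurableSpace K] {T : ℝ≥0}

lemma mem_afterJump_zero (N : MarkedPointProcess P K T) {s : ℝ≥0} {ω : Ω} :
    (s, ω) ∈ N.afterJump 0 ↔ s ∈ Ioc 0 T := by
  simp [afterJump, N.S_zero]

lemma enorm_sub_rpow_le {p : ℝ} (hp : 1 ≤ p) (a b : ℝ) :
    ‖a - b‖ₑ ^ p ≤ 2 ^ (p - 1) * (‖a‖ₑ ^ p + ‖b‖ₑ ^ p) :=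
  (ENNReal.rpow_le_rpow enorm_sub_le (by linarith)).trans
    (ENNReal.rpow_add_le_mul_rpow_add_rpow _ _ hp)

lemma IsPredictable.sub {N : MarkedPointProcess P K T} {Z Z' : ℝ≥0 → Ω → K → ℝ}
    (hZ : N.IsPredictable Z) (hZ' : N.IsPredictable Z') :
    N.IsPredictable fun s ω x => Z s ω x - Z' s ω x := by
  have : Measurable[N.predictableSigma.prod mK] fun q => cutValue T Z q - cutValue T Z' q :=
    Measurable.sub hZ hZ'
  simp_rw [← cutValue_sub] at this
  exact this

lemma IsPredictable.measurable_marks {N : MarkedPointProcess P K T} {Z : ℝ≥0 → Ω → K → ℝ}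
    (hZ : N.IsPredictable Z) {s : ℝ≥0} (hs : s ≤ T) (ω : Ω) : Measurable (Z s ω) := by
  have := (Compensator.measurable_section hZ ω).comp (measurable_prodMk_left (x := s))
  simpa [Function.comp_def, hs] using this

namespace Compensator

variable {N : MarkedPointProcess P K T} (c : N.Compensator)

lemma IsSolution.isLinearSolution {c : N.Compensator} {ξ : Ω → ℝ}
    {f : Ω → ℝ≥0 → K → ℝ → (K → ℝ) → ℝ}
    {Y : ℝ≥0 → Ω → ℝ} {Z : ℝ≥0 → Ω → K → ℝ} (h : c.IsSolution ξ f Y Z) :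
    c.IsLinearSolution ξ
      (fun ω q => f ω q.1 q.2 (Function.leftLim (fun s => Y s ω) q.1) (Z q.1 ω)) Y Z :=
  ⟨h.adapted, h.left_limits, h.predictable, h.integrable_f, h.equation⟩

lemma IsLinearSolution.sub [MeasurableSingletonClass K] {c : N.Compensator} {ξ ξ' : Ω → ℝ}
    {g g' : Ω → ℝ≥0 × K → ℝ}
    {Y Y' : ℝ≥0 → Ω → ℝ} {Z Z' : ℝ≥0 → Ω → K → ℝ} (h : c.IsLinearSolution ξ g Y Z)
    (h' : c.IsLinearSolution ξ' g' Y' Z') :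
    c.IsLinearSolution (fun ω => ξ ω - ξ' ω) (fun ω q => g ω q - g' ω q)
      (fun s ω => Y s ω - Y' s ω) (fun s ω x => Z s ω x - Z' s ω x) where
  adapted t ht := (h.adapted t ht).sub (h'.adapted t ht)
  left_limits ω t ht := by
    obtain ⟨l, hl⟩ := h.left_limits ω t ht
    obtain ⟨l', hl'⟩ := h'.left_limits ω t ht
    exact ⟨l - l', hl.sub hl'⟩
  predictable := h.predictable.sub h'.predictable
  integrable := by
    filter_upwards [h.integrable, h'.integrable] with ω h1 h2 using h1.sub h2
  equation := by
    filter_upwards [h.integrable, h'.integrable, h.equation, h'.equation] with ω i1 i2 e1 e2 t ht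
    have hsub : Ioc t T ×ˢ (univ : Set K) ⊆ Ioc 0 T ×ˢ univ :=
      prod_mono_left (Ioc_subset_Ioc_left zero_le)
    have e1 := e1 t ht
    have e2 := e2 t ht
    rw [N.setIntegral_jumpMeasure] at e1 e2 ⊢
    rw [Finset.sum_sub_distrib, integral_sub (i1.mono_set hsub) (i2.mono_set hsub)]
    simp only at e1 e2
    linarith

/-- The time marginal of `ν` is `dA`, since `φ` consists of probability measures. -/
lemma ae_ν_of_ae_dA {ω : Ω} {r : ℝ≥0 → Prop} (h : ∀ᵐ s ∂(c.dA ω), r s) :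
    ∀ᵐ q ∂(c.ν ω), r q.1 := by
  have hfst : (c.ν ω).map Prod.fst = c.dA ω := by
    rw [← Kernel.fst_apply, ν_eq, Kernel.fst_compProd]
  exact ae_of_ae_map measurable_fst.aemeasurable (hfst ▸ h)

/-- The norm of a solution, in terms of its left limits. -/
lemma IsLinearSolution.normLp_eq [MeasurableSingletonClass K] {c : N.Compensator}
    (hc : c.ContinuousA) {ξ : Ω → ℝ} {g : Ω → ℝ≥0 × K → ℝ} {Y : ℝ≥0 → Ω → ℝ}
    {Z : ℝ≥0 → Ω → K → ℝ} (h : c.IsLinearSolution ξ g Y Z) (p β : ℝ) :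
    c.normLp p β Y Z = c.energyY p β 0 Y + c.energyZ p β 0 Z := by
  have hYm := N.measurable_leftValue h.adapted h.left_limits
  rw [energyY, energyZ, ← c.expect_add
    (c.measurable_weightAfter_mul β 0 (measurable_enorm_leftValue (mK := mK) p hYm)), expect,
    normLp]
  refine lintegral_congr_ae ?_
  filter_upwards [c.nullSingletonClass_dA hc, h.integrable, h.equation] with ω hnull hg heq
  rw [← lintegral_indicator (measurableSet_Ioc.prod MeasurableSet.univ)]
  refine lintegral_congr_ae ?_
  filter_upwards [c.ae_ν_of_ae_dA (c.leftValue_ae_eq hg heq)] with q hq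
  by_cases hmem : q.1 ∈ Ioc 0 T
  · have hW : c.weightAfter β 0 (q.1, ω) = c.weight β q.1 ω :=
      indicator_of_mem (N.mem_afterJump_zero.2 hmem) _
    rw [indicator_of_mem (by exact ⟨hmem, mem_univ _⟩), hW]
    simp only [hq hmem, cutValue, hmem.2, if_true]
    ring
  · have hW : c.weightAfter β 0 (q.1, ω) = 0 :=
      indicator_of_notMem (fun h => hmem (N.mem_afterJump_zero.1 h)) _
    rw [indicator_of_notMem (fun h => hmem h.1), hW]
    simp

/-- Supplies, for the difference of two solutions, the finiteness that the absorption step requires.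
-/
lemma energyY_sub_ne_top {p β : ℝ} (hp : 1 ≤ p) {Y Y' : ℝ≥0 → Ω → ℝ}
    (hY : ∀ ω, ∀ t ≤ T, ∃ l, Tendsto (fun s => Y s ω) (𝓝[<] t) (𝓝 l))
    (hY' : ∀ ω, ∀ t ≤ T, ∃ l, Tendsto (fun s => Y' s ω) (𝓝[<] t) (𝓝 l))
    (hYa : ∀ t ≤ T, Measurable[N.filtration t] (Y t))
    (h : c.energyY p β 0 Y ≠ ∞) (h' : c.energyY p β 0 Y' ≠ ∞) :
    c.energyY p β 0 (fun s ω => Y s ω - Y' s ω) ≠ ∞ := by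
  have h2 : (2 : ℝ≥0∞) ^ (p - 1) ≠ ∞ := by finiteness
  refine ne_top_of_le_ne_top (b := 2 ^ (p - 1) * (c.energyY p β 0 Y + c.energyY p β 0 Y'))
    (by finiteness) ?_
  rw [energyY, energyY, energyY, ← c.expect_add (c.measurable_weightAfter_mul β 0
    (measurable_enorm_leftValue (mK := mK) p (N.measurable_leftValue hYa hY))),
    ← c.expect_const_mul h2]
  refine c.expect_mono fun q => ?_
  rw [leftValue_sub hY hY']
  refine (mul_le_mul_right (enorm_sub_rpow_le hp _ _) _).trans_eq ?_
  ring

lemma energyZ_sub_ne_top {p β : ℝ} (hp : 1 ≤ p) {Z Z' : ℝ≥0 → Ω → K → ℝ}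
    (hZ : N.IsPredictable Z) (h : c.energyZ p β 0 Z ≠ ∞) (h' : c.energyZ p β 0 Z' ≠ ∞) :
    c.energyZ p β 0 (fun s ω x => Z s ω x - Z' s ω x) ≠ ∞ := by
  have h2 : (2 : ℝ≥0∞) ^ (p - 1) ≠ ∞ := by finiteness
  refine ne_top_of_le_ne_top (b := 2 ^ (p - 1) * (c.energyZ p β 0 Z + c.energyZ p β 0 Z'))
    (by finiteness) ?_
  rw [energyZ, energyZ, energyZ, ← c.expect_add (c.measurable_weightAfter_mul β 0
    (measurable_enorm_cutValue p hZ)), ← c.expect_const_mul h2]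
  refine c.expect_mono fun q => ?_
  rw [cutValue_sub]
  refine (mul_le_mul_right (enorm_sub_rpow_le hp _ _) _).trans_eq ?_
  ring

/-- A predictable process whose weighted energy on `(S k, T]` vanishes is zero there. -/
lemma ae_eq_zero_of_expect_eq_zero {p β : ℝ} (hp : 0 < p) (k : ℕ) {u : (ℝ≥0 × Ω) × K → ℝ}
    (hu : Measurable[N.predictableSigma.prod mK] u)
    (h : c.expect (fun q => c.weightAfter β k q.1 * ‖u q‖ₑ ^ p) = 0) :
    ∀ᵐ ω ∂P, ∀ᵐ s ∂(c.dA ω), (s, ω) ∈ N.afterJump k → ∀ᵐ x ∂(c.φ (s, ω)), u ((s, ω), x) = 0 := by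
  have hm := c.measurable_weightAfter_mul β k ((measurable_enorm.comp hu).pow_const p)
  have h0 := (lintegral_eq_zero_iff (c.measurable_lintegral_ν hm)).1 h
  filter_upwards [h0] with ω hω
  have h1 := (lintegral_eq_zero_iff (measurable_section hm ω)).1 hω
  rw [ν_eq] at h1
  filter_upwards [Kernel.ae_ae_of_ae_compProd h1] with s hs hmem
  filter_upwards [hs] with x hx
  have hW : c.weightAfter β k (s, ω) ≠ 0 := by
    rw [weightAfter, indicator_of_mem hmem]
    exact c.weight_ne_zero _ _ _
  have := (mul_eq_zero.1 hx).resolve_left hW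
  rw [ENNReal.rpow_eq_zero_iff_of_pos hp] at this
  simpa using this

/-! ### Consequences of the conditions on the generator. -/

section Truncation

variable {p β : ℝ} {L L' : ℝ≥0}
  {f : Ω → ℝ≥0 → K → ℝ → (K → ℝ) → ℝ}

lemma GeneratorHyp.predictable_zero {c : N.Compensator} (hf : c.GeneratorHyp p β L L' f) :
    Measurable[N.predictableSigma.prod mK]
      fun q : (ℝ≥0 × Ω) × K => if q.1.1 ≤ T then f q.1.2 q.1.1 q.2 0 0 else 0 := by
  have h0 : N.IsPredictable fun (_ : ℝ≥0) (_ : Ω) (_ : K) => (0 : ℝ) := by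
    unfold IsPredictable
    simp
  have h := hf.predictable _ h0
  have hmap : Measurable[N.predictableSigma.prod mK,
      N.predictableSigma.prod (mK.prod (inferInstance : MeasurableSpace ℝ))]
      fun q : (ℝ≥0 × Ω) × K => (q.1, (q.2, (0 : ℝ))) :=
    Measurable.prodMk measurable_fst (Measurable.prodMk measurable_snd measurable_const)
  exact h.comp hmap

/-- The generator at the origin, on `(S m, T]`. -/
def sourceAfter (N : MarkedPointProcess P K T) (f : Ω → ℝ≥0 → K → ℝ → (K → ℝ) → ℝ) (m : ℕ)
    (q : (ℝ≥0 × Ω) × K) : ℝ≥0∞ :=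
  (N.afterJump m).indicator (fun r => ‖f r.2 r.1 q.2 0 0‖ₑ) q.1

lemma GeneratorHyp.measurable_sourceAfter {c : N.Compensator} (hf : c.GeneratorHyp p β L L' f)
    (m : ℕ) : Measurable[N.predictableSigma.prod mK] (sourceAfter N f m) := by
  have h : Measurable[N.predictableSigma.prod mK] ((Prod.fst ⁻¹' N.afterJump m).indicator
      fun q : (ℝ≥0 × Ω) × K => ‖if q.1.1 ≤ T then f q.1.2 q.1.1 q.2 0 0 else 0‖ₑ) :=
    (measurable_enorm.comp hf.predictable_zero).indicator
      (measurable_fst (N.measurableSet_afterJump m))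
  convert! h using 1
  ext q
  by_cases hq : q.1 ∈ N.afterJump m
  · have : q ∈ Prod.fst ⁻¹' N.afterJump m := hq
    rw [indicator_of_mem this, sourceAfter, indicator_of_mem hq, if_pos hq.2]
  · have : q ∉ Prod.fst ⁻¹' N.afterJump m := hq
    rw [indicator_of_notMem this, sourceAfter, indicator_of_notMem hq]

/-- First `y` is changed at fixed `ζ`, pointwise in `x`; then `ζ` at fixed `y'`, where the control
holds only after averaging over `x`. -/
lemma GeneratorHyp.lintegral_sub_le {c : N.Compensator} (hf : c.GeneratorHyp p β L L' f) (ω : Ω)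
    {s : ℝ≥0} (hs : s ≤ T) (y y' : ℝ) {ζ ζ' : K → ℝ} (hζ : Measurable ζ) (hζ' : Measurable ζ') :
    ∫⁻ x, ‖f ω s x y ζ - f ω s x y' ζ'‖ₑ ∂(c.φ (s, ω))
      ≤ L' * ‖y - y'‖ₑ + L * (∫⁻ x, ‖ζ x - ζ' x‖ₑ ^ p ∂(c.φ (s, ω))) ^ (1 / p) := by
  have h1 : ∀ x, ‖f ω s x y ζ - f ω s x y' ζ'‖ₑ
      ≤ L' * ‖y - y'‖ₑ + ‖f ω s x y' ζ - f ω s x y' ζ'‖ₑ := by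
    intro x
    have e : f ω s x y ζ - f ω s x y' ζ'
        = (f ω s x y ζ - f ω s x y' ζ) + (f ω s x y' ζ - f ω s x y' ζ') := by ring
    rw [e]
    refine (enorm_add_le _ _).trans ?_
    gcongr
    have := hf.lipschitz_y ω s hs x y' y ζ hζ
    have h := ENNReal.ofReal_le_ofReal this
    rwa [ENNReal.ofReal_mul L'.coe_nonneg, ENNReal.ofReal_coe_nnreal, ← Real.norm_eq_abs,
      ← Real.norm_eq_abs, ofReal_norm, ofReal_norm] at h
  refine (lintegral_mono h1).trans ?_
  rw [lintegral_add_left measurable_const, lintegral_const, measure_univ, mul_one]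
  gcongr
  refine (hf.lipschitz_z ω s hs y' ζ ζ' hζ hζ').trans_eq ?_
  simp_rw [← enorm_neg (ζ' _ - ζ _), neg_sub]

lemma GeneratorHyp.lintegral_le {c : N.Compensator} (hf : c.GeneratorHyp p β L L' f) (ω : Ω)
    {s : ℝ≥0} (hs : s ≤ T) (y : ℝ) {ζ : K → ℝ} (hζ : Measurable ζ) :
    ∫⁻ x, ‖f ω s x y ζ‖ₑ ∂(c.φ (s, ω))
      ≤ L' * ‖y‖ₑ + L * (∫⁻ x, ‖ζ x‖ₑ ^ p ∂(c.φ (s, ω))) ^ (1 / p)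
        + ∫⁻ x, ‖f ω s x 0 0‖ₑ ∂(c.φ (s, ω)) := by
  have hm : Measurable fun x => ‖f ω s x 0 0‖ₑ := by
    have := ((measurable_section hf.predictable_zero ω).comp
      (measurable_prodMk_left (x := s))).enorm
    simpa [Function.comp_def, hs] using this
  have h1 : ∀ x, ‖f ω s x y ζ‖ₑ ≤ ‖f ω s x y ζ - f ω s x 0 0‖ₑ + ‖f ω s x 0 0‖ₑ := by
    intro x
    simpa using enorm_add_le (f ω s x y ζ - f ω s x 0 0) (f ω s x 0 0)
  refine (lintegral_mono h1).trans ?_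
  rw [lintegral_add_right _ hm]
  gcongr
  simpa using hf.lintegral_sub_le ω hs y 0 hζ measurable_zero

end Truncation

end Compensator

end MarkedPointProcess

/-! ### The truncation error and its limit. -/

namespace MarkedPointProcess

namespace Compensator

variable {Ω : Type*} [mΩ : MeasurableSpace Ω] {P : Measure Ω}
  {K : Type*} [mK : MeasurableSpace K] {T : ℝ≥0} {N : MarkedPointProcess P K T}

variable {c : N.Compensator} {p ε β : ℝ} {L L' : ℝ≥0} {R₀ R₁ : ℝ} {C : ℝ≥0}
  {f : Ω → ℝ≥0 → K → ℝ → (K → ℝ) → ℝ} {ξ : Ω → ℝ} {Y : ℝ≥0 → Ω → ℝ} {Z : ℝ≥0 → Ω → K → ℝ}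
  {m : ℕ} {Ym : ℝ≥0 → Ω → ℝ} {Zm : ℝ≥0 → Ω → K → ℝ}

/-- Puts the error in the form produced by the a priori estimate with `k = 0`: the weight covers all
of `(0, T]` and the restriction to `(S m, T]` sits in the source. -/
lemma errorBound_eq (hf : c.GeneratorHyp p β L L' f) (hp : 0 < p) (m : ℕ) :
    c.errorBound p β ξ f m
      = ∫⁻ ω, {ω | N.S m ω < T}.indicator (fun ω => ‖ξ ω‖ₑ ^ p * c.weight β T ω) ω ∂P
        + c.expect fun q => c.weightAfter β 0 q.1 * sourceAfter N f m q ^ p := by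
  have hm := c.measurable_weightAfter_mul β 0 ((hf.measurable_sourceAfter m).pow_const p)
  rw [expect, ← lintegral_add_right _ (c.measurable_lintegral_ν hm), errorBound]
  refine lintegral_congr fun ω => ?_
  congr 1
  have hset : MeasurableSet {q : ℝ≥0 × K | min (N.S m ω) T < q.1 ∧ q.1 ≤ T} :=
    MeasurableSet.inter (s₁ := {q : ℝ≥0 × K | min (N.S m ω) T < q.1}) (s₂ := {q | q.1 ≤ T})
      (measurableSet_lt measurable_const (measurable_coe_nnreal_ennreal.comp measurable_fst))
      (measurableSet_le measurable_fst measurable_const)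
  rw [← lintegral_indicator hset]
  refine lintegral_congr fun q => ?_
  by_cases hq : (q.1, ω) ∈ N.afterJump m
  · have h1 : q ∈ {q : ℝ≥0 × K | min (N.S m ω) T < q.1 ∧ q.1 ≤ T} :=
      ⟨min_lt_of_left_lt hq.1, hq.2⟩
    have h0 : (q.1, ω) ∈ N.afterJump 0 :=
      ⟨(N.S_monotone ω (Nat.zero_le m)).trans_lt hq.1, hq.2⟩
    rw [indicator_of_mem h1, sourceAfter, indicator_of_mem hq, weightAfter, indicator_of_mem h0,
      mul_comm]
  · have h1 : q ∉ {q : ℝ≥0 × K | min (N.S m ω) T < q.1 ∧ q.1 ≤ T} := by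
      rintro ⟨h1, h2⟩
      refine hq ⟨(min_lt_iff.1 h1).resolve_right (not_lt.2 ?_), h2⟩
      exact_mod_cast h2
    rw [indicator_of_notMem h1, sourceAfter, indicator_of_notMem hq, ENNReal.zero_rpow_of_pos hp,
      mul_zero]

lemma energy_ne_top [MeasurableSingletonClass K] (hc : c.ContinuousA) {g : Ω → ℝ≥0 × K → ℝ}
    (h : c.IsLinearSolution ξ g Y Z) (hmem : c.MemLp p β Y Z) :
    c.energyY p β 0 Y ≠ ∞ ∧ c.energyZ p β 0 Z ≠ ∞ := by
  have := hmem.norm_lt_top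
  rw [h.normLp_eq hc] at this
  exact ENNReal.add_ne_top.1 this.ne

lemma measurable_truncTerminal (hξ : Measurable ξ) (m : ℕ) : Measurable (N.truncTerminal m ξ) :=
  hξ.indicator (measurableSet_lt measurable_const (N.measurable_S m))

/-- A solution of the truncated equation vanishes on `(S m, T]`. -/
lemma truncated_vanishes [MeasurableSingletonClass K] (hc : c.ContinuousA) (hp : 1 < p)
    (hε : 0 < ε) (hβ : 0 ≤ β) (hC : IsAprioriConstant p ε β L L' R₀ R₁ C) (hξ : Measurable ξ)
    (hsol : c.IsSolution (N.truncTerminal m ξ) (N.truncGenerator m f) Ym Zm)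
    (hmem : c.MemLp p β Ym Zm) :
    ∀ᵐ ω ∂P, ∀ᵐ s ∂(c.dA ω), (s, ω) ∈ N.afterJump m →
      leftValue T Ym (s, ω) = 0 ∧ ∀ᵐ x ∂(c.φ (s, ω)), Zm s ω x = 0 := by
  have hp0 : 0 < p := by linarith
  have hlin := hsol.isLinearSolution
  obtain ⟨hY, hZ⟩ := energy_ne_top hc hlin hmem
  have key := c.apriori_estimate hc hp hε hβ hC
    (measurable_truncTerminal hξ m) hlin (h := fun _ => 0) measurable_const m
    -- After `S m` the truncated generator is identically zero, so the source can be taken to be 0.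
    (Eventually.of_forall fun ω => Eventually.of_forall fun s hs => by
      have : ¬ (s : ℝ≥0∞) ≤ N.S m ω := not_le.2 hs.1
      simp [truncGenerator, this])
    (ne_top_of_le_ne_top hY (c.energyY_le p β m Ym))
    (ne_top_of_le_ne_top hZ (c.energyZ_le p β m Zm))
  have hX : ∀ ω, {ω | N.S m ω ≤ T}.indicator
      (fun ω => c.weight β T ω * ‖N.truncTerminal m ξ ω‖ₑ ^ p) ω = 0 := by
    intro ω
    by_cases h : N.S m ω ≤ T
    · have : ω ∉ {ω | (T : ℝ≥0∞) < N.S m ω} := not_lt.2 h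
      rw [indicator_of_mem (by exact h), truncTerminal, indicator_of_notMem this]
      simp [hp0]
    · rw [indicator_of_notMem (by exact h)]
  have hH : (c.expect fun q => c.weightAfter β m q.1 * (0 : ℝ≥0∞) ^ p) = 0 := by
    simp [hp0, expect]
  simp_rw [hX] at key
  rw [hH, lintegral_zero, add_zero, mul_zero, nonpos_iff_eq_zero, add_eq_zero] at key
  have hYm := N.measurable_leftValue hlin.adapted hlin.left_limits
  have h1 := c.ae_eq_zero_of_expect_eq_zero hp0 m (u := fun q => leftValue T Ym q.1)
    (hYm.comp measurable_fst) key.1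
  have h2 := c.ae_eq_zero_of_expect_eq_zero hp0 m hlin.predictable key.2
  filter_upwards [h1, h2] with ω hω1 hω2
  filter_upwards [hω1, hω2] with s hs1 hs2 hmem
  refine ⟨by simpa using hs1 hmem, ?_⟩
  filter_upwards [hs2 hmem] with x hx
  simpa [hmem.2] using hx

/-- The estimate of the truncation error. -/
theorem normLp_truncation_le [MeasurableSingletonClass K] (hc : c.ContinuousA) (hp : 1 < p)
    (hε : 0 < ε) (hβ : 0 ≤ β) (hC : IsAprioriConstant p ε β L L' R₀ R₁ C)
    (hξ : c.TerminalHyp p β ξ) (hf : c.GeneratorHyp p β L L' f) (hsol : c.IsSolution ξ f Y Z)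
    (hmem : c.MemLp p β Y Z) (hm : 1 ≤ m)
    (hsolm : c.IsSolution (N.truncTerminal m ξ) (N.truncGenerator m f) Ym Zm)
    (hmemm : c.MemLp p β Ym Zm) :
    c.normLp p β (fun s ω => Y s ω - Ym s ω) (fun s ω x => Z s ω x - Zm s ω x)
      ≤ C * c.errorBound p β ξ f m := by
  have hp0 : 0 < p := by linarith
  have hξm : Measurable ξ := hξ.measurable.mono (N.filtration.le T) le_rfl
  have hlin := hsol.isLinearSolution
  have hlinm := hsolm.isLinearSolution
  have hdiff := hlin.sub hlinm
  obtain ⟨hY, hZ⟩ := energy_ne_top hc hlin hmem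
  obtain ⟨hYm, hZm⟩ := energy_ne_top hc hlinm hmemm
  rw [hdiff.normLp_eq hc, errorBound_eq hf hp0]
  -- The terminal values differ by `ξ` on `{S m ≤ T}`; the inequality becomes strict because `S m ≠
  -- T` almost surely.
  have hterm : ∫⁻ ω, {ω | N.S 0 ω ≤ T}.indicator
        (fun ω => c.weight β T ω * ‖ξ ω - N.truncTerminal m ξ ω‖ₑ ^ p) ω ∂P
      = ∫⁻ ω, {ω | N.S m ω < T}.indicator (fun ω => ‖ξ ω‖ₑ ^ p * c.weight β T ω) ω ∂P := by
    refine lintegral_congr_ae ?_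
    filter_upwards [c.ae_S_ne_horizon hc hm] with ω hω
    rw [indicator_of_mem (by simp [N.S_zero])]
    rcases lt_or_gt_of_ne hω with h | h
    · have : ω ∉ {ω | (T : ℝ≥0∞) < N.S m ω} := not_lt.2 h.le
      rw [indicator_of_mem (by exact h), truncTerminal, indicator_of_notMem this, sub_zero,
        mul_comm]
    · rw [indicator_of_notMem (by exact not_lt.2 h.le), truncTerminal,
        indicator_of_mem (by exact h)]
      simp [hp0]
  rw [← hterm]
  refine c.apriori_estimate hc hp hε hβ hC
    (hξm.sub (measurable_truncTerminal hξm m)) hdiff (hf.measurable_sourceAfter m) 0 ?_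
    (c.energyY_sub_ne_top hp.le hlin.left_limits hlinm.left_limits hlin.adapted hY hYm)
    (c.energyZ_sub_ne_top hp.le hlin.predictable hZ hZm)
  filter_upwards [truncated_vanishes hc hp hε hβ hC hξm hsolm hmemm] with ω hω
  filter_upwards [hω] with s hs hs0
  have hsT := hs0.2
  have hsIoc := N.mem_afterJump_zero.1 hs0
  have hZs := hlin.predictable.measurable_marks hsT ω
  have hZms := hlinm.predictable.measurable_marks hsT ω
  have hy : Function.leftLim (fun r => Y r ω) s = leftValue T Y (s, ω) := by
    simp only [leftValue, hsIoc, if_true]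
  have hym : Function.leftLim (fun r => Ym r ω) s = leftValue T Ym (s, ω) := by
    simp only [leftValue, hsIoc, if_true]
  rw [leftValue_sub hlin.left_limits hlinm.left_limits]
  simp only [hy, hym]
  -- After `S m` the truncated solution vanishes, so bounding `f(Y, Z)` by its Lipschitz part and
  -- `f(·,0,0)` bounds it in terms of the difference. Up to `S m` both equations have the same
  -- generator and no source appears.
  by_cases hmem : (s, ω) ∈ N.afterJump m
  · have htr : ¬ (s : ℝ≥0∞) ≤ N.S m ω := not_le.2 hmem.1
    obtain ⟨hy0, hz0⟩ := hs hmem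
    have hzint : ∫⁻ x, ‖Z s ω x - Zm s ω x‖ₑ ^ p ∂(c.φ (s, ω))
        = ∫⁻ x, ‖Z s ω x‖ₑ ^ p ∂(c.φ (s, ω)) := by
      refine lintegral_congr_ae ?_
      filter_upwards [hz0] with x hx
      rw [hx, sub_zero]
    simp only [truncGenerator, htr, if_false, sub_zero, hy0, hzint, sourceAfter,
      indicator_of_mem hmem]
    exact hf.lintegral_le ω hsT _ hZs
  · have htr : (s : ℝ≥0∞) ≤ N.S m ω := by
      by_contra h
      exact hmem ⟨not_le.1 h, hsT⟩
    simp only [truncGenerator, htr, if_true, sourceAfter, indicator_of_notMem hmem,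
      lintegral_zero, add_zero]
    exact hf.lintegral_sub_le ω hsT _ _ hZs hZms

/-- The error is at most the integral over `{S m ≤ T}` of one integrable variable, and these events
decrease to the empty set by non-explosion. -/
lemma tendsto_errorBound [IsProbabilityMeasure P] (hξ : c.TerminalHyp p β ξ)
    (hf : c.GeneratorHyp p β L L' f) :
    Tendsto (fun m => c.errorBound p β ξ f m) atTop (𝓝 0) := by
  have hξm : Measurable ξ := hξ.measurable.mono (N.filtration.le T) le_rfl
  set G : Ω → ℝ≥0∞ := fun ω => c.weight β T ω * ‖ξ ω‖ₑ ^ p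
    + ∫⁻ q in Ioc 0 T ×ˢ univ, c.weight β q.1 ω * ‖f ω q.1 q.2 0 0‖ₑ ^ p ∂(c.ν ω) with hG
  have hGfin : ∫⁻ ω, G ω ∂P ≠ ∞ := by
    have hm : Measurable fun ω => c.weight β T ω * ‖ξ ω‖ₑ ^ p :=
      (c.measurable_weight_time β T).mul (hξm.enorm.pow_const p)
    rw [hG, lintegral_add_left hm]
    exact ENNReal.add_ne_top.2 ⟨hξ.integrable.ne, hf.integrable.ne⟩
  have hmeas : ∀ m, MeasurableSet {ω | N.S m ω ≤ T} := fun m =>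
    measurableSet_le (N.measurable_S m) measurable_const
  have hP : Tendsto (fun m => P {ω | N.S m ω ≤ T}) atTop (𝓝 0) := by
    have h := tendsto_measure_iInter_atTop (μ := P) (s := fun m => {ω | N.S m ω ≤ T})
      (fun m => (hmeas m).nullMeasurableSet)
      (fun i j hij ω (hω : N.S j ω ≤ T) => (N.S_monotone ω hij).trans hω)
      ⟨0, measure_ne_top _ _⟩
    have he : ⋂ m, {ω | N.S m ω ≤ T} = ∅ := by
      ext ω
      obtain ⟨n, hn⟩ := N.non_explosive ω
      simp only [mem_iInter, mem_empty_iff_false, iff_false, not_forall]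
      exact ⟨n, not_le.2 hn⟩
    rwa [he, measure_empty] at h
  refine tendsto_of_tendsto_of_tendsto_of_le_of_le tendsto_const_nhds
    (tendsto_setLIntegral_zero hGfin hP) (fun _ => zero_le) fun m => ?_
  dsimp only
  rw [← lintegral_indicator (hmeas m), errorBound]
  refine lintegral_mono fun ω => ?_
  by_cases hω : N.S m ω ≤ T
  · rw [indicator_of_mem (show ω ∈ {ω | N.S m ω ≤ T} from hω)]
    refine add_le_add ?_ ?_
    · refine (indicator_le_self _ _ _).trans_eq (mul_comm _ _)
    · simp_rw [mul_comm (‖f ω _ _ 0 0‖ₑ ^ p)]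
      refine lintegral_mono_set fun q hq => ⟨⟨?_, hq.2⟩, mem_univ _⟩
      exact_mod_cast lt_of_le_of_lt zero_le hq.1
  · have hlt : ω ∉ {ω | N.S m ω < T} := fun h => hω (le_of_lt h)
    rw [indicator_of_notMem (show ω ∉ {ω | N.S m ω ≤ T} from hω), indicator_of_notMem hlt]
    have : {q : ℝ≥0 × K | min (N.S m ω) T < q.1 ∧ q.1 ≤ T} = ∅ := by
      ext q
      simp only [mem_ofPred_eq, mem_empty_iff_false, iff_false, not_and, not_le]
      intro h
      rw [min_eq_right (le_of_not_ge hω)] at h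
      exact_mod_cast h
    rw [this]
    simp

end Compensator

end MarkedPointProcess

end BSDE

end

theorem proposition4p1 (p ε β : ℝ) (L L' : ℝ≥0) (hp : 1 < p) (hε : 0 < ε)
    (hβ : BSDE.betaBound p ε L L' < β) :
    ∃ C : ℝ≥0, ∀ (Ω : Type*) [MeasurableSpace Ω] (P : Measure Ω) [IsProbabilityMeasure P]
      (K : Type*) [MeasurableSpace K] [StandardBorelSpace K] (T : ℝ≥0) (_ : 0 < T)
      (N : BSDE.MarkedPointProcess P K T) (c : N.Compensator) (_ : c.ContinuousA)
      (ξ : Ω → ℝ) (_ : c.TerminalHyp p β ξ)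
      (f : Ω → ℝ≥0 → K → ℝ → (K → ℝ) → ℝ) (_ : c.GeneratorHyp p β L L' f)
      (Y : ℝ≥0 → Ω → ℝ) (Z : ℝ≥0 → Ω → K → ℝ)
      (_ : c.IsSolution ξ f Y Z) (_ : c.MemLp p β Y Z),
      (∀ m, 1 ≤ m → ∀ (Ym : ℝ≥0 → Ω → ℝ) (Zm : ℝ≥0 → Ω → K → ℝ),
        c.IsSolution (N.truncTerminal m ξ) (N.truncGenerator m f) Ym Zm → c.MemLp p β Ym Zm →
          c.normLp p β (fun s ω => Y s ω - Ym s ω) (fun s ω x => Z s ω x - Zm s ω x)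
            ≤ C * c.errorBound p β ξ f m) ∧
      (∀ (Ym : ℕ → ℝ≥0 → Ω → ℝ) (Zm : ℕ → ℝ≥0 → Ω → K → ℝ),
        (∀ m, 1 ≤ m →
          c.IsSolution (N.truncTerminal m ξ) (N.truncGenerator m f) (Ym m) (Zm m) ∧
            c.MemLp p β (Ym m) (Zm m)) →
        Tendsto (fun m => c.normLp p β (fun s ω => Y s ω - Ym m s ω)
          (fun s ω x => Z s ω x - Zm m s ω x)) atTop (𝓝 0)) := by
  -- The constant is fixed before the probability space, the process and `m` are introduced, so it
  -- depends on `(p, ε, β, L, L')` alone.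
  obtain ⟨R₀, R₁, C, hC⟩ := BSDE.exists_isAprioriConstant hp hε hβ
  have hβ0 : 0 ≤ β := BSDE.betaBound_nonneg hp hε L.coe_nonneg L'.coe_nonneg |>.trans hβ.le
  refine ⟨C, ?_⟩
  intro Ω _ P _ K _ _ T _ N c hc ξ hξ f hf Y Z hsol hmem
  refine ⟨fun m hm Ym Zm hsolm hmemm =>
    BSDE.MarkedPointProcess.Compensator.normLp_truncation_le hc hp hε hβ0 hC hξ hf hsol
      hmem hm hsolm hmemm, ?_⟩
  intro Ym Zm hm
  have hlim : Tendsto (fun m => (C : ℝ≥0∞) * c.errorBound p β ξ f m) atTop (𝓝 0) := by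
    simpa using ENNReal.Tendsto.const_mul
      (BSDE.MarkedPointProcess.Compensator.tendsto_errorBound hξ hf)
      (Or.inr (ENNReal.coe_ne_top (r := C)))
  refine tendsto_of_tendsto_of_tendsto_of_le_of_le' tendsto_const_nhds hlim
    (Eventually.of_forall fun _ => zero_le) ?_
  filter_upwards [eventually_ge_atTop 1] with m hm1
  exact BSDE.MarkedPointProcess.Compensator.normLp_truncation_le hc hp hε hβ0 hC hξ hf hsol
    hmem hm1 (hm m hm1).1 (hm m hm1).2
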